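/- Let $\nu$ be a non-zero finite Borel measure on $(0,1)$ and let $\Lambda$ be Lebesgue measure. Let $H^1_0(0,1)$ be the space of functions $f:[0,1]\to\mathbb R$ with $f(0)=f(1)=0$ for which there is $\nabla f\in L^2([0,1],\Lambda)$ with $f(x)=f(0)+\int_{[0,x]}\nabla f\,d\Lambda$ for all $x\in[0,1]$. Let $\operatorname{dom}(\mathcal E_\nu)$ be the set of $f\in H^1_0(0,1)$ that are affine linear on every connected component of $[0,1]\setminus\operatorname{supp}\nu$, and $\mathcal E_\nu(f,g)=\int_{(0,1)}\nabla f\,\nabla g\,d\Lambda$. A number $\lambda\in\mathbb R$ is an eigenvalue of $\mathcal E_\nu$ with eigenfunction $f\in\operatorname{dom}(\mathcal E_\nu)\setminus\{0\}$ if $\mathcal E_\nu(f,g)=\lambda\int fg\,d\nu$ for all $g\in\operatorname{dom}(\mathcal E_\nu)$. Let $N_\nu(x)$ be the number of eigenvalues of $\mathcal E_\nu$ not exceeding $x$, counted with multiplicity, and let $$\underline s_\nu=\liminf_{x\to\infty}\frac{\log N_\nu(x)}{\log x}$$ be the lower spectral dimension of $\nu$. For $q\in\mathbb R$ put $$\beta_n^\nu(q)=\frac1{\log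 2^n}\log\sum_{C}\nu(C)^q,\qquad \beta_\nu(q)=\limsup_{n\to\infty}\beta_n^\nu(q)\in[-\infty,\infty],$$ where the sum is over the intervals $C=(k2^{-n},(k+1)2^{-n}]$, $0\le k<2^n$, with $\nu(C)>0$, and let $$\partial\beta_\nu(q)=\{s\in\mathbb R:\ \beta_\nu(t)\ge s(t-q)+\beta_\nu(q)\ \text{for all } t\in\mathbb R\}.$$ **Proposition 1.5.** Let $q\in[0,1]$ be such that $\beta_\nu(q)=\lim_{n\to\infty}\beta_n^\nu(q)$, and suppose that $-\partial\beta_\nu(q)=[a,b]$ with $a\le b$, where $a\in\mathbb R$ and $b\in\mathbb R\cup\{\infty\}$ (for $b=\infty$ read $[a,b]$ as $[a,\infty)$). Then $$\frac{aq+\beta_\nu(q)}{1+b}\le\underline s_\nu ,$$ where the left-hand side is $0$ if $b=\infty$. -/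

import Mathlib

open MeasureTheory Filter Topology
open scoped Pointwise

noncomputable section

namespace KreinFeller

/-- `g` is a weak derivative of `f` on `[0,1]`: `g ∈ L²([0,1])` with respect to Lebesgue measure
and `f x = f 0 + ∫_{[0,x]} g` for all `x ∈ [0,1]`. -/
def HasWeakDeriv (f g : ℝ → ℝ) : Prop :=
  MemLp g 2 (volume.restrict (Set.Icc 0 1)) ∧
    ∀ x ∈ Set.Icc (0 : ℝ) 1, f x = f 0 + ∫ t in Set.Icc 0 x, g t

open Classical in
/-- A representative of the weak derivative of `f` (which is unique up to Lebesgue null sets);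
zero if `f` has no weak derivative. -/
def weakDeriv (f : ℝ → ℝ) : ℝ → ℝ :=
  if h : ∃ g, HasWeakDeriv f g then h.choose else 0

/-- The Sobolev space `H₀¹(0,1)`. Since its elements vanish at `0` and `1`, a function on `[0,1]`
is identified with its extension by zero to the real line. -/
def SobolevH10 : Set (ℝ → ℝ) :=
  {f | (∃ g, HasWeakDeriv f g) ∧ ∀ x ∉ Set.Ioo (0 : ℝ) 1, f x = 0}

/-- Functions which are continuous on `[0,1]` and affine linear on each connected component
of `[0,1] \ supp ν`. -/
def AffineOffSupport (ν : Measure ℝ) : Set (ℝ → ℝ) :=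
  {f | ContinuousOn f (Set.Icc 0 1) ∧
    ∀ x ∈ Set.Icc (0 : ℝ) 1 \ ν.support, ∃ c d : ℝ,
      ∀ y ∈ connectedComponentIn (Set.Icc (0 : ℝ) 1 \ ν.support) x, f y = c * y + d}

/-- The (Dirichlet) domain of the form `ℰ_ν`. -/
def formDomain (ν : Measure ℝ) : Set (ℝ → ℝ) :=
  SobolevH10 ∩ AffineOffSupport ν

/-- The form `ℰ_ν(f, g) = ∫_{(0,1)} ∇f ∇g dΛ`. -/
def energy (f g : ℝ → ℝ) : ℝ :=
  ∫ x in Set.Ioo (0 : ℝ) 1, weakDeriv f x * weakDeriv g x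

/-- `f` is an eigenfunction of `ℰ_ν` with eigenvalue `μ`. -/
def IsEigenfunction (ν : Measure ℝ) (μ : ℝ) (f : ℝ → ℝ) : Prop :=
  f ∈ formDomain ν ∧ f ≠ 0 ∧ ∀ g ∈ formDomain ν, energy f g = μ * ∫ x, f x * g x ∂ν

/-- The eigenvalue counting function `N_ν(x)`: the number of eigenvalues of `ℰ_ν` not exceeding
`x`, counted with multiplicity. As eigenspaces to different eigenvalues are linearly independent,
this is the dimension of the span of all eigenfunctions with eigenvalue at most `x`. -/
def eigenvalueCount (ν : Measure ℝ) (x : ℝ) : ℕ∞ :=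
  Cardinal.toENat
    (Module.rank ℝ (Submodule.span ℝ {f : ℝ → ℝ | ∃ μ ≤ x, IsEigenfunction ν μ f}))

/-- The lower spectral dimension `liminf_{x → ∞} log N_ν(x) / log x`. -/
def lowerSpectralDim (ν : Measure ℝ) : EReal :=
  liminf (fun x : ℝ => ENNReal.log (eigenvalueCount ν x : ENNReal) / (Real.log x : EReal)) atTop

/-- The dyadic interval `(k 2⁻ⁿ, (k+1) 2⁻ⁿ]`. -/
def dyadic (n k : ℕ) : Set ℝ := Set.Ioc ((k : ℝ) / 2 ^ n) (((k : ℝ) + 1) / 2 ^ n)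

open Classical in
/-- `β_n^ν(q) = (1 / log 2ⁿ) log ∑ ν(C)^q`, the sum being over the dyadic subintervals `C` of
`(0,1]` of length `2⁻ⁿ` with `ν(C) > 0`. -/
def lqSpectrumAt (ν : Measure ℝ) (n : ℕ) (q : ℝ) : ℝ :=
  1 / Real.log (2 ^ n) *
    Real.log (∑ k ∈ (Finset.range (2 ^ n)).filter (fun k => 0 < ν (dyadic n k)),
      ν.real (dyadic n k) ^ q)

/-- The `L^q`-spectrum `β_ν(q) = limsup_n β_n^ν(q)`; it may be `+∞` for `q < 0`. -/
def lqSpectrum (ν : Measure ℝ) (q : ℝ) : EReal :=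
  limsup (fun n : ℕ => (lqSpectrumAt ν n q : EReal)) atTop

/-- The subdifferential `∂β_ν(q)`. -/
def lqSubdifferential (ν : Measure ℝ) (q : ℝ) : Set ℝ :=
  {s | ∀ t : ℝ, ((s * (t - q) : ℝ) : EReal) + lqSpectrum ν q ≤ lqSpectrum ν t}

end KreinFeller

end

/-! Many separated dyadic intervals of not too small mass force many small eigenvalues, and the
subdifferential at `q` says how many such intervals there are.

Spectral side. A function in the form domain is encoded by its gradient in `L²([0,1])`, where
evaluation at `y` is the inner product with the indicator of `[0,y]`. The form `∫ f g dν` then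
becomes a compact positive symmetric operator, and its eigenvalue `r > 0` corresponds to the
eigenvalue `1/r` of the energy form. By min-max (`card_le_eigenvalueCount`), a family of trial
functions on whose span the energy is less than `x ∫ f² dν` gives that many eigenvalues up to `x`. A
trapezoid over a dyadic interval of length `2⁻ⁿ` has energy `2·2ⁿ`, so separated intervals of mass
at least `m` yield one eigenvalue each below any `x > 2·2ⁿ/m` (`card_le_eigenvalueCount_of_dyadic`).

Counting side. Write `B = β(q)`. Since `a - ε` and `b + ε` lie outside `-∂β(q)`, Chernoff-type
estimates (`exists_tail_bound`) show that intervals of mass above `2^{-n(a-ε)}` or below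
`2^{-n(b+ε)}` contribute to `∑ ν(C)^q` with an exponent strictly less than `B`. As `β_n(q)`
converges to `B`, the remaining intervals carry at least half of a lower bound of exponent close to
`B`; each contributes at most `2^{-n(a-ε)q}`, so there are about `2^{n(aq+B)}` of them, all of mass
at least `2^{-n(b+ε)}` (`eventually_exists_many_dyadic`).

Together, about `2^{n(aq+B)}` eigenvalues lie below about `2^{n(1+b)}`;
`le_lowerSpectralDim_of_eventually` passes from these scales to all `x`. -/

namespace KreinFeller

open scoped InnerProductSpace

/-! ### Compact positive operators and min-max -/

section Hilbert

variable {H : Type*} [NormedAddCommGroup H] [InnerProductSpace ℝ H]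

/-- The span of the eigenvectors of `T` with eigenvalue at least `l`. -/
def topEigenspan (T : H →L[ℝ] H) (l : ℝ) : Submodule ℝ H :=
  Submodule.span ℝ {u | ∃ r, l ≤ r ∧ T u = r • u}

theorem topEigenspan_invariant (T : H →L[ℝ] H) (l : ℝ) {u : H} (hu : u ∈ topEigenspan T l) :
    T u ∈ topEigenspan T l := by
  induction hu using Submodule.span_induction with
  | mem u hu =>
    obtain ⟨r, hr, h⟩ := hu
    rw [h]
    exact Submodule.smul_mem _ _ (Submodule.subset_span ⟨r, hr, h⟩)
  | zero => simp
  | add u v _ _ hu hv => rw [map_add]; exact add_mem hu hv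
  | smul c u _ hu => rw [map_smul]; exact Submodule.smul_mem _ _ hu

theorem integrable_rankOne {ν : Measure ℝ} [IsFiniteMeasure ν] {k : ℝ → H}
    (hk : Continuous k) {C : ℝ} (hC : ∀ y, ‖k y‖ ≤ C) :
    Integrable (fun y => InnerProductSpace.rankOne ℝ (k y) (k y)) ν := by
  have hcont : Continuous (fun y => InnerProductSpace.rankOne ℝ (k y) (k y)) :=
    ((InnerProductSpace.rankOne ℝ).continuous.comp hk).clm_apply hk
  have hC0 : 0 ≤ C := (norm_nonneg _).trans (hC 0)
  refine Integrable.of_bound hcont.aestronglyMeasurable (C * C) (Eventually.of_forall fun y => ?_)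
  rw [InnerProductSpace.norm_rankOne]
  exact mul_le_mul (hC y) (hC y) (norm_nonneg _) hC0

variable [CompleteSpace H]

/-- The norm of a positive compact self-adjoint operator is an eigenvalue. -/
theorem hasEigenvalue_norm_of_isCompactOperator {T : H →L[ℝ] H} (hT : IsCompactOperator T)
    (hsymm : T.IsSymmetric) (hpos : ∀ u, 0 ≤ ⟪T u, u⟫_ℝ) (hT0 : T ≠ 0) :
    Module.End.HasEigenvalue (T : Module.End ℝ H) ‖T‖ := by
  have hn : ‖T‖ ≠ 0 := norm_ne_zero_iff.2 hT0
  have : Nontrivial H := by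
    by_contra h
    rw [not_nontrivial_iff_subsingleton] at h
    exact hT0 (Subsingleton.elim _ _)
  -- Fredholm alternative. In the resolvent case the Rayleigh quotients stay `ε` below `‖T‖`,
  -- although by symmetry and positivity their supremum is `‖T‖`.
  refine (hT.hasEigenvalue_or_mem_resolventSet hn).resolve_right fun hres => ?_
  obtain ⟨ε, hε, h⟩ := T.rayleighQuotient_le_of_norm_mem_resolventSet (𝕜 := ℝ) hres
  have h2 := T.norm_eq_iSup_rayleighQuotient hsymm
  have h3 : (⨆ x, |T.rayleighQuotient x|) ≤ ‖T‖ - ε := by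
    refine ciSup_le fun x => ?_
    rw [abs_of_nonneg]
    · exact h x
    · exact div_nonneg (hpos x) (by positivity)
  linarith

/-- By symmetry the orthogonal complement is invariant. If the restriction of `T` to it had norm
above `l`, that norm would be an eigenvalue, with an eigenvector lying both in the span and in its
complement. -/
theorem inner_le_of_mem_topEigenspan_orthogonal {T : H →L[ℝ] H} (hT : IsCompactOperator T)
    (hsymm : T.IsSymmetric) (hpos : ∀ u, 0 ≤ ⟪T u, u⟫_ℝ) {l : ℝ} (hl : 0 ≤ l) {u : H}
    (hu : u ∈ (topEigenspan T l)ᗮ) : ⟪T u, u⟫_ℝ ≤ l * ‖u‖ ^ 2 := by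
  have hinv : ∀ v ∈ (topEigenspan T l)ᗮ, T v ∈ (topEigenspan T l)ᗮ := by
    intro v hv w hw
    have := hsymm w v
    rw [ContinuousLinearMap.coe_coe] at this
    rw [← this]
    exact hv _ (topEigenspan_invariant T l hw)
  let S : (topEigenspan T l)ᗮ →L[ℝ] (topEigenspan T l)ᗮ := T.restrict hinv
  have hS_compact : IsCompactOperator S := hT.restrict' hinv
  have hS_symm : S.IsSymmetric := hsymm.restrict_invariant hinv
  have hSn : ‖S‖ ≤ l := by
    by_contra! hlt
    have hS0 : S ≠ 0 := by
      intro h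
      have : ‖S‖ = 0 := by rw [h]; exact ContinuousLinearMap.opNorm_zero
      linarith
    obtain ⟨v, hv⟩ := (hasEigenvalue_norm_of_isCompactOperator hS_compact hS_symm
      (fun v => hpos v) hS0).exists_hasEigenvector
    have h1 : T (v : H) = ‖S‖ • (v : H) := congrArg Subtype.val hv.apply_eq_smul
    have h2 : (v : H) ∈ topEigenspan T l := Submodule.subset_span ⟨_, hlt.le, h1⟩
    have h3 : (v : H) = 0 := inner_self_eq_zero.1 (v.2 _ h2)
    exact hv.2 (Subtype.ext h3)
  have h4 : ⟪S ⟨u, hu⟩, ⟨u, hu⟩⟫_ℝ ≤ ‖S ⟨u, hu⟩‖ * ‖(⟨u, hu⟩ : (topEigenspan T l)ᗮ)‖ :=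
    real_inner_le_norm _ _
  have h5 := S.le_opNorm ⟨u, hu⟩
  have h6 : ‖(⟨u, hu⟩ : (topEigenspan T l)ᗮ)‖ = ‖u‖ := rfl
  have h7 : ⟪S ⟨u, hu⟩, ⟨u, hu⟩⟫_ℝ = ⟪T u, u⟫_ℝ := rfl
  rw [h6] at h4 h5
  rw [h7] at h4
  calc ⟪T u, u⟫_ℝ ≤ (‖S‖ * ‖u‖) * ‖u‖ := h4.trans (by gcongr)
    _ ≤ (l * ‖u‖) * ‖u‖ := by gcongr
    _ = l * ‖u‖ ^ 2 := by ring

/-- A form of the min-max principle: if the Rayleigh quotient exceeds `l` on the range of a linear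
map from `ι → ℝ`, then the eigenvectors for eigenvalues at least `l` span a space of dimension at
least `card ι`. -/
theorem card_le_rank_topEigenspan {T : H →L[ℝ] H} (hT : IsCompactOperator T)
    (hsymm : T.IsSymmetric) (hpos : ∀ u, 0 ≤ ⟪T u, u⟫_ℝ) {l : ℝ} (hl : 0 ≤ l)
    {ι : Type*} [Fintype ι] (L : (ι → ℝ) →ₗ[ℝ] H)
    (hL : ∀ c ≠ 0, l * ‖L c‖ ^ 2 < ⟪T (L c), L c⟫_ℝ) :
    (Fintype.card ι : ℕ∞) ≤ Cardinal.toENat (Module.rank ℝ (topEigenspan T l)) := by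
  by_cases hfin : FiniteDimensional ℝ (topEigenspan T l)
  · rw [← Module.finrank_eq_rank]
    simp only [map_natCast, Nat.cast_le]
    by_contra! hlt
    let P : (ι → ℝ) →ₗ[ℝ] topEigenspan T l :=
      ((topEigenspan T l).orthogonalProjectionOnto : H →ₗ[ℝ] topEigenspan T l) ∘ₗ L
    -- Too small a dimension yields a nonzero `c` with `L c` orthogonal to the span, where the
    -- Rayleigh quotient is at most `l`.
    have hker : P.ker ≠ ⊥ := P.ker_ne_bot_of_finrank_lt (by simpa using hlt)
    obtain ⟨c, hc, hc0⟩ := Submodule.exists_mem_ne_zero_of_ne_bot hker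
    have hmem : L c ∈ (topEigenspan T l)ᗮ := by
      rw [← Submodule.orthogonalProjectionOnto_eq_zero_iff]
      exact hc
    exact (hL c hc0).not_ge (inner_le_of_mem_topEigenspan_orthogonal hT hsymm hpos hl hmem)
  · have : Cardinal.aleph0 ≤ Module.rank ℝ (topEigenspan T l) := by
      by_contra! h
      exact hfin (Module.rank_lt_aleph0_iff.1 h)
    rw [Cardinal.toENat_eq_top.2 this]
    exact le_top

/-- The integral operator `u ↦ ∫ ⟪k y, u⟫ k y dν(y)`. -/
noncomputable def kernelOperator (ν : Measure ℝ) (k : ℝ → H) : H →L[ℝ] H :=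
  ∫ y, InnerProductSpace.rankOne ℝ (k y) (k y) ∂ν

variable {ν : Measure ℝ} [IsFiniteMeasure ν] {k : ℝ → H}

theorem inner_kernelOperator (hk : Continuous k) {C : ℝ} (hC : ∀ y, ‖k y‖ ≤ C) (u v : H) :
    ⟪kernelOperator ν k u, v⟫_ℝ = ∫ y, ⟪k y, u⟫_ℝ * ⟪k y, v⟫_ℝ ∂ν := by
  have hi := integrable_rankOne (ν := ν) hk hC
  rw [kernelOperator, ContinuousLinearMap.integral_apply hi, real_inner_comm,
    ← integral_inner (hi.apply_continuousLinearMap u)]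
  refine integral_congr_ae (Eventually.of_forall fun y => ?_)
  simp [InnerProductSpace.rankOne_apply, inner_smul_right, real_inner_comm]

theorem kernelOperator_isSymmetric (hk : Continuous k) {C : ℝ} (hC : ∀ y, ‖k y‖ ≤ C) :
    (kernelOperator ν k).IsSymmetric := by
  intro u v
  change ⟪kernelOperator ν k u, v⟫_ℝ = ⟪u, kernelOperator ν k v⟫_ℝ
  rw [inner_kernelOperator hk hC, real_inner_comm, inner_kernelOperator hk hC]
  simp only [mul_comm]

/-- Up to the factor `ν(ℝ)` this is an average of rank-one operators, and the compact operators form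
a closed convex set. -/
theorem kernelOperator_isCompact (hk : Continuous k) {C : ℝ} (hC : ∀ y, ‖k y‖ ≤ C) :
    IsCompactOperator (kernelOperator ν k) := by
  let M : Submodule ℝ (H →L[ℝ] H) := compactOperator (RingHom.id ℝ) H H
  have hM : IsClosed (M : Set (H →L[ℝ] H)) := isClosed_setOfPred_isCompactOperator
  have : kernelOperator ν k ∈ M := by
    by_cases hν : ν = 0
    · simp [kernelOperator, hν]
    have : NeZero ν := ⟨hν⟩
    have h1 : (⨍ y, InnerProductSpace.rankOne ℝ (k y) (k y) ∂ν) ∈ (M : Set (H →L[ℝ] H)) := by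
      refine M.convex.average_mem hM (Eventually.of_forall fun y => ?_)
        (integrable_rankOne hk hC)
      change IsCompactOperator _
      rw [InnerProductSpace.rankOne_def']
      exact (isCompactOperator_of_locallyCompactSpace_rng
        (ContinuousLinearMap.toSpanSingleton ℝ (k y))).comp_clm _
    rw [average_eq] at h1
    have h2 := M.smul_mem (ν.real Set.univ) h1
    rwa [smul_inv_smul₀ (by simp [Measure.real, ENNReal.toReal_eq_zero_iff, hν])] at h2
  exact this

end Hilbert

/-! ### The form domain as a space of gradients -/

/-- The Hilbert space `L²([0,1])`. -/
abbrev L2Unit : Type := Lp ℝ 2 (volume.restrict (Set.Icc (0 : ℝ) 1))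

/-- The indicator function of `[0,y]` in `L²([0,1])`; it represents the functional which sends a
gradient to the value at `y` of its primitive. -/
noncomputable def evalVec (y : ℝ) : L2Unit :=
  indicatorConstLp 2 (measurableSet_Iic (a := y)) (measure_ne_top _ _) 1

theorem inner_evalVec (y : ℝ) (u : L2Unit) :
    ⟪evalVec y, u⟫_ℝ = ∫ t in Set.Iic y, u t ∂(volume.restrict (Set.Icc (0 : ℝ) 1)) := by
  rw [evalVec, L2.inner_indicatorConstLp_one]

theorem setIntegral_Iic_restrict_unit {y : ℝ} (hy : y ∈ Set.Icc (0 : ℝ) 1) (f : ℝ → ℝ) :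
    ∫ t in Set.Iic y, f t ∂(volume.restrict (Set.Icc (0 : ℝ) 1)) = ∫ t in Set.Icc 0 y, f t := by
  rw [Measure.restrict_restrict measurableSet_Iic]
  congr 2
  ext t
  simp only [Set.mem_inter_iff, Set.mem_Iic, Set.mem_Icc] at hy ⊢
  constructor
  · rintro ⟨h1, h2, h3⟩; exact ⟨h2, h1⟩
  · rintro ⟨h1, h2⟩; exact ⟨h2, h1, h2.trans hy.2⟩

/-- Clamping to `[0,1]` covers all real points; continuity and boundedness of `evalVec` are needed
on the whole line to integrate against `ν`. -/
theorem inner_evalVec_evalVec (x y : ℝ) :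
    ⟪evalVec x, evalVec y⟫_ℝ = max 0 (min 1 (min x y)) := by
  rw [inner_evalVec, evalVec, setIntegral_congr_ae (g := (Set.Iic y).indicator fun _ => (1 : ℝ))
    measurableSet_Iic (indicatorConstLp_coeFn.mono fun t h _ => h),
    setIntegral_indicator measurableSet_Iic, setIntegral_const, smul_eq_mul, mul_one, Measure.real,
    Measure.restrict_apply (measurableSet_Iic.inter measurableSet_Iic), Set.Iic_inter_Iic]
  have : Set.Iic (x ⊓ y) ∩ Set.Icc 0 1 = Set.Icc 0 (min 1 (min x y)) := by
    ext t
    simp only [Set.mem_inter_iff, Set.mem_Iic, Set.mem_Icc, le_min_iff]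
    tauto
  rw [this, Real.volume_Icc, sub_zero, ENNReal.toReal_ofReal', max_comm]

theorem inner_evalVec_of_mem {x y : ℝ} (hx : x ∈ Set.Icc (0 : ℝ) 1) (hy : y ∈ Set.Icc (0 : ℝ) 1) :
    ⟪evalVec x, evalVec y⟫_ℝ = min x y := by
  rw [inner_evalVec_evalVec, min_eq_right (min_le_of_left_le hx.2),
    max_eq_right (le_min hx.1 hy.1)]

theorem continuous_evalVec : Continuous evalVec := by
  rw [continuous_iff_continuousAt]
  intro x
  rw [ContinuousAt, tendsto_iff_norm_sub_tendsto_zero]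
  have h : ∀ y, ‖evalVec y - evalVec x‖ = √(max 0 (min 1 (min y y)) -
      2 * max 0 (min 1 (min y x)) + max 0 (min 1 (min x x))) := by
    intro y
    rw [← inner_evalVec_evalVec, ← inner_evalVec_evalVec, ← inner_evalVec_evalVec,
      real_inner_self_eq_norm_sq, real_inner_self_eq_norm_sq, ← norm_sub_sq_real,
      Real.sqrt_sq (norm_nonneg _)]
  simp_rw [h]
  have hc : Continuous fun y : ℝ => √(max 0 (min 1 (min y y)) -
      2 * max 0 (min 1 (min y x)) + max 0 (min 1 (min x x))) := by fun_prop
  convert! hc.tendsto x using 2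
  rw [eq_comm, Real.sqrt_eq_zero']
  linarith

theorem norm_evalVec_le (y : ℝ) : ‖evalVec y‖ ≤ 1 := by
  have h : ‖evalVec y‖ ^ 2 ≤ 1 := by
    rw [← real_inner_self_eq_norm_sq, inner_evalVec_evalVec]
    exact max_le zero_le_one (min_le_left _ _)
  nlinarith [norm_nonneg (evalVec y)]

theorem integrable_L2Unit (u : L2Unit) : Integrable u (volume.restrict (Set.Icc (0 : ℝ) 1)) :=
  (Lp.memLp u).integrable one_le_two

/-- A primitive determines its gradient: half-lines are a π-system generating the Borel sets, so `u`
has integral zero over every Borel set. -/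
theorem eq_zero_of_inner_evalVec {u : L2Unit}
    (h : ∀ y ∈ Set.Icc (0 : ℝ) 1, ⟪evalVec y, u⟫_ℝ = 0) : u = 0 := by
  have hi := integrable_L2Unit u
  have hIic : ∀ y, ∫ t in Set.Iic y, u t ∂(volume.restrict (Set.Icc (0 : ℝ) 1)) = 0 := by
    intro y
    rcases lt_or_ge y 0 with hy | hy
    · rw [Measure.restrict_restrict measurableSet_Iic]
      have : Set.Iic y ∩ Set.Icc 0 1 = ∅ := by
        ext t
        simp only [Set.mem_inter_iff, Set.mem_Iic, Set.mem_Icc, Set.mem_empty_iff_false, iff_false]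
        rintro ⟨h1, h2, -⟩
        linarith
      simp [this]
    · rcases le_or_gt y 1 with hy1 | hy1
      · rw [← inner_evalVec]; exact h y ⟨hy, hy1⟩
      · have h1 := h 1 ⟨zero_le_one, le_rfl⟩
        rw [inner_evalVec] at h1
        refine Eq.trans ?_ h1
        rw [Measure.restrict_restrict measurableSet_Iic,
          Measure.restrict_restrict measurableSet_Iic]
        congr 2
        ext t
        simp only [Set.mem_inter_iff, Set.mem_Iic, Set.mem_Icc]
        constructor
        · rintro ⟨-, h2, h3⟩; exact ⟨h3, h2, h3⟩
        · rintro ⟨-, h2, h3⟩; exact ⟨h3.trans hy1.le, h2, h3⟩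
  have huniv : ∫ t, u t ∂(volume.restrict (Set.Icc (0 : ℝ) 1)) = 0 := by
    refine Eq.trans ?_ (hIic 1)
    rw [Measure.restrict_restrict measurableSet_Iic]
    congr 2
    ext t
    simp only [Set.mem_inter_iff, Set.mem_Iic, Set.mem_Icc]
    tauto
  have hall : ∀ s, MeasurableSet s →
      ∫ t in s, u t ∂(volume.restrict (Set.Icc (0 : ℝ) 1)) = 0 := by
    intro s hs
    induction s, hs using MeasurableSpace.induction_on_inter
      (borel_eq_generateFrom_Iic ℝ ▸ BorelSpace.measurable_eq) isPiSystem_Iic with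
    | empty => simp
    | basic s hs => obtain ⟨y, rfl⟩ := hs; exact hIic y
    | compl s hs ih => rw [setIntegral_compl hs hi, ih, huniv, sub_zero]
    | iUnion f hd hf ih =>
      rw [integral_iUnion hf hd hi.integrableOn]
      simp [ih]
  have := hi.ae_eq_zero_of_forall_setIntegral_eq_zero fun s hs _ => hall s hs
  exact (Lp.eq_zero_iff_ae_eq_zero).2 this

theorem HasWeakDeriv.inner_evalVec_toLp {f g : ℝ → ℝ} (h : HasWeakDeriv f g) (h0 : f 0 = 0) {y : ℝ}
    (hy : y ∈ Set.Icc (0 : ℝ) 1) : ⟪evalVec y, h.1.toLp g⟫_ℝ = f y := by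
  have hf := h.2 y hy
  rw [h0, zero_add] at hf
  rw [inner_evalVec, hf, ← setIntegral_Iic_restrict_unit hy]
  exact setIntegral_congr_ae measurableSet_Iic (h.1.coeFn_toLp.mono fun t h _ => h)

/-- The function in `H₀¹` with a given gradient. -/
noncomputable def primitive : L2Unit →ₗ[ℝ] (ℝ → ℝ) where
  toFun u := (Set.Ioo (0 : ℝ) 1).indicator fun y => ⟪evalVec y, u⟫_ℝ
  map_add' u v := by
    ext y
    by_cases hy : y ∈ Set.Ioo (0 : ℝ) 1 <;> simp [hy, inner_add_right]
  map_smul' c u := by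
    ext y
    by_cases hy : y ∈ Set.Ioo (0 : ℝ) 1 <;> simp [hy, inner_smul_right]

theorem primitive_of_notMem (u : L2Unit) {x : ℝ} (hx : x ∉ Set.Ioo (0 : ℝ) 1) :
    primitive u x = 0 := by
  change (Set.Ioo (0 : ℝ) 1).indicator (fun y => ⟪evalVec y, u⟫_ℝ) x = 0
  exact Set.indicator_of_notMem hx _

theorem inner_evalVec_zero (u : L2Unit) : ⟪evalVec 0, u⟫_ℝ = 0 := by
  have : evalVec 0 = 0 := by
    rw [← inner_self_eq_zero (𝕜 := ℝ), inner_evalVec_evalVec]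
    simp
  rw [this, inner_zero_left]

theorem primitive_apply {u : L2Unit} (hu : ⟪evalVec 1, u⟫_ℝ = 0) {y : ℝ}
    (hy : y ∈ Set.Icc (0 : ℝ) 1) : primitive u y = ⟪evalVec y, u⟫_ℝ := by
  change (Set.Ioo (0 : ℝ) 1).indicator (fun y => ⟪evalVec y, u⟫_ℝ) y = _
  by_cases h : y ∈ Set.Ioo (0 : ℝ) 1
  · rw [Set.indicator_of_mem h]
  · rw [Set.indicator_of_notMem h]
    rcases eq_or_lt_of_le hy.1 with h0 | h0
    · rw [← h0, inner_evalVec_zero]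
    · rcases eq_or_lt_of_le hy.2 with h1 | h1
      · rw [h1, hu]
      · exact absurd ⟨h0, h1⟩ h

theorem primitive_injOn {u : L2Unit} (hu : ⟪evalVec 1, u⟫_ℝ = 0) (h : primitive u = 0) : u = 0 :=
  eq_zero_of_inner_evalVec fun y hy => by rw [← primitive_apply hu hy, h, Pi.zero_apply]

theorem hasWeakDeriv_primitive {u : L2Unit} (hu : ⟪evalVec 1, u⟫_ℝ = 0) :
    HasWeakDeriv (primitive u) u := by
  refine ⟨Lp.memLp u, fun x hx => ?_⟩
  rw [primitive_apply hu hx, primitive_apply hu ⟨le_rfl, zero_le_one⟩, inner_evalVec_zero,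
    zero_add, inner_evalVec, setIntegral_Iic_restrict_unit hx]

/-- The gradients of the functions in the domain of the form. -/
noncomputable def gradientSpace (ν : Measure ℝ) : Submodule ℝ L2Unit :=
  (Submodule.span ℝ ({evalVec 1} ∪ {w | ∃ x ∈ Set.Icc (0 : ℝ) 1 \ ν.support,
    ∃ p ∈ connectedComponentIn (Set.Icc (0 : ℝ) 1 \ ν.support) x,
    ∃ r ∈ connectedComponentIn (Set.Icc (0 : ℝ) 1 \ ν.support) x,
    ∃ s ∈ connectedComponentIn (Set.Icc (0 : ℝ) 1 \ ν.support) x,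
      w = (s - r) • evalVec p + (p - s) • evalVec r + (r - p) • evalVec s}))ᗮ

/-- Affinity on a component amounts to the vanishing of all three-point combinations. These are
closed linear conditions on the gradient, so the space can be defined as an orthogonal complement
and is complete. -/
theorem mem_gradientSpace_iff {ν : Measure ℝ} {u : L2Unit} : u ∈ gradientSpace ν ↔
    ⟪evalVec 1, u⟫_ℝ = 0 ∧ ∀ x ∈ Set.Icc (0 : ℝ) 1 \ ν.support,
    ∀ p ∈ connectedComponentIn (Set.Icc (0 : ℝ) 1 \ ν.support) x,
    ∀ r ∈ connectedComponentIn (Set.Icc (0 : ℝ) 1 \ ν.support) x,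
    ∀ s ∈ connectedComponentIn (Set.Icc (0 : ℝ) 1 \ ν.support) x,
      (s - r) * ⟪evalVec p, u⟫_ℝ + (p - s) * ⟪evalVec r, u⟫_ℝ + (r - p) * ⟪evalVec s, u⟫_ℝ
        = 0 := by
  rw [gradientSpace, Submodule.mem_orthogonal]
  constructor
  · intro h
    refine ⟨h _ (Submodule.subset_span (Or.inl rfl)), fun x hx p hp r hr s hs => ?_⟩
    have := h _ (Submodule.subset_span (Or.inr ⟨x, hx, p, hp, r, hr, s, hs, rfl⟩))
    simpa only [inner_add_left, real_inner_smul_left] using this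
  · rintro ⟨h1, h2⟩ w hw
    induction hw using Submodule.span_induction with
    | mem w hw =>
      rcases hw with rfl | ⟨x, hx, p, hp, r, hr, s, hs, rfl⟩
      · exact h1
      · simpa only [inner_add_left, real_inner_smul_left] using h2 x hx p hp r hr s hs
    | zero => exact inner_zero_left _
    | add v w _ _ hv hw => rw [inner_add_left, hv, hw, add_zero]
    | smul c v _ hv => rw [real_inner_smul_left, hv, mul_zero]

theorem primitive_mem_formDomain {ν : Measure ℝ} {u : L2Unit} (hu : u ∈ gradientSpace ν) :
    primitive u ∈ formDomain ν := by
  rw [mem_gradientSpace_iff] at hu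
  obtain ⟨h1, h2⟩ := hu
  refine ⟨⟨⟨u, hasWeakDeriv_primitive h1⟩, fun x hx => primitive_of_notMem u hx⟩, ?_, ?_⟩
  · refine ContinuousOn.congr (f := fun y => ⟪evalVec y, u⟫_ℝ) ?_ fun y hy => primitive_apply h1 hy
    exact (continuous_evalVec.inner continuous_const).continuousOn
  · intro x hx
    have hsub := connectedComponentIn_subset (Set.Icc (0 : ℝ) 1 \ ν.support) x
    have hxm := mem_connectedComponentIn hx
    -- A second point of the component determines the slope; on a one-point component a constant
    -- serves.
    by_cases hz : ∃ z ∈ connectedComponentIn (Set.Icc (0 : ℝ) 1 \ ν.support) x, z ≠ x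
    · obtain ⟨z, hz, hzx⟩ := hz
      have hzx' : z - x ≠ 0 := sub_ne_zero.2 hzx
      refine ⟨(⟪evalVec z, u⟫_ℝ - ⟪evalVec x, u⟫_ℝ) / (z - x),
        ⟪evalVec x, u⟫_ℝ - (⟪evalVec z, u⟫_ℝ - ⟪evalVec x, u⟫_ℝ) / (z - x) * x, fun y hy => ?_⟩
      rw [primitive_apply h1 (hsub hy).1]
      have := h2 x hx x hxm z hz y hy
      field_simp
      linarith
    · push Not at hz
      refine ⟨0, primitive u x, fun y hy => ?_⟩
      rw [hz y hy]
      ring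

theorem exists_gradient_of_mem_formDomain {ν : Measure ℝ} {f : ℝ → ℝ} (hf : f ∈ formDomain ν) :
    ∃ v ∈ gradientSpace ν, weakDeriv f =ᵐ[volume.restrict (Set.Icc (0 : ℝ) 1)] v ∧
      ∀ y ∈ Set.Icc (0 : ℝ) 1, f y = ⟪evalVec y, v⟫_ℝ := by
  obtain ⟨⟨hex, h0⟩, -, haff⟩ := hf
  have hw : HasWeakDeriv f (weakDeriv f) := by
    rw [weakDeriv, dif_pos hex]
    exact hex.choose_spec
  have hval : ∀ y ∈ Set.Icc (0 : ℝ) 1, f y = ⟪evalVec y, hw.1.toLp _⟫_ℝ := fun y hy =>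
    (hw.inner_evalVec_toLp (h0 0 (by simp)) hy).symm
  refine ⟨hw.1.toLp _, ?_, hw.1.coeFn_toLp.symm, hval⟩
  rw [mem_gradientSpace_iff]
  refine ⟨by rw [← hval 1 ⟨zero_le_one, le_rfl⟩, h0 1 (by simp)], fun x hx p hp r hr s hs => ?_⟩
  obtain ⟨c, d, hcd⟩ := haff x hx
  have hsub := connectedComponentIn_subset (Set.Icc (0 : ℝ) 1 \ ν.support) x
  rw [← hval p (hsub hp).1, ← hval r (hsub hr).1, ← hval s (hsub hs).1, hcd p hp, hcd r hr,
    hcd s hs]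
  ring

/-- The representative chosen by `weakDeriv` has the same primitive as `u`, hence agrees with it
almost everywhere. -/
theorem weakDeriv_primitive {ν : Measure ℝ} {u : L2Unit} (hu : u ∈ gradientSpace ν) :
    weakDeriv (primitive u) =ᵐ[volume.restrict (Set.Icc (0 : ℝ) 1)] u := by
  obtain ⟨v, -, hv, hval⟩ := exists_gradient_of_mem_formDomain (primitive_mem_formDomain hu)
  have : v - u = 0 := eq_zero_of_inner_evalVec fun y hy => by
    rw [inner_sub_right, ← hval y hy, primitive_apply (mem_gradientSpace_iff.1 hu).1 hy, sub_self]
  rwa [sub_eq_zero.1 this] at hv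

theorem energy_eq_inner {f g : ℝ → ℝ} {u v : L2Unit}
    (hf : weakDeriv f =ᵐ[volume.restrict (Set.Icc (0 : ℝ) 1)] u)
    (hg : weakDeriv g =ᵐ[volume.restrict (Set.Icc (0 : ℝ) 1)] v) : energy f g = ⟪u, v⟫_ℝ := by
  rw [energy, ← integral_Icc_eq_integral_Ioo, L2.inner_def]
  refine integral_congr_ae ?_
  filter_upwards [hf, hg] with t h1 h2
  rw [h1, h2, real_inner_comm]
  rfl

/-- The primitive is the Dirichlet Green function `y ↦ min y x - x y`, whose only kink is at `x`. As
`x` lies in the support, every component of the complement is on one side of it. -/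
theorem sub_smul_evalVec_mem_gradientSpace {ν : Measure ℝ} {x : ℝ} (hx : x ∈ Set.Ioo (0 : ℝ) 1)
    (hs : x ∈ ν.support) : evalVec x - x • evalVec 1 ∈ gradientSpace ν := by
  have h01 : (1 : ℝ) ∈ Set.Icc (0 : ℝ) 1 := ⟨zero_le_one, le_rfl⟩
  have hx' : x ∈ Set.Icc (0 : ℝ) 1 := ⟨hx.1.le, hx.2.le⟩
  have hin : ∀ y ∈ Set.Icc (0 : ℝ) 1,
      ⟪evalVec y, evalVec x - x • evalVec 1⟫_ℝ = min y x - x * y := fun y hy => by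
    rw [inner_sub_right, real_inner_smul_right, inner_evalVec_of_mem hy hx',
      inner_evalVec_of_mem hy h01, min_eq_left hy.2]
  rw [mem_gradientSpace_iff]
  refine ⟨by rw [hin 1 h01, min_eq_right hx.2.le]; ring, fun z hz p hp r hr s hs' => ?_⟩
  set A := connectedComponentIn (Set.Icc (0 : ℝ) 1 \ ν.support) z with hA
  have hsub : A ⊆ _ := connectedComponentIn_subset (Set.Icc (0 : ℝ) 1 \ ν.support) z
  have hord : A.OrdConnected := isPreconnected_connectedComponentIn.ordConnected
  have hxA : x ∉ A := fun h => (hsub h).2 hs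
  have hside : (∀ y ∈ A, y ≤ x) ∨ ∀ y ∈ A, x ≤ y := by
    by_contra! h
    obtain ⟨⟨y, hy, hxy⟩, w, hw, hwx⟩ := h
    exact hxA (hord.out hw hy ⟨hwx.le, hxy.le⟩)
  rw [hin p (hsub hp).1, hin r (hsub hr).1, hin s (hsub hs').1]
  rcases hside with h | h
  · rw [min_eq_left (h p hp), min_eq_left (h r hr), min_eq_left (h s hs')]
    ring
  · rw [min_eq_right (h p hp), min_eq_right (h r hr), min_eq_right (h s hs')]
    ring

instance (ν : Measure ℝ) : CompleteSpace (gradientSpace ν) := by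
  unfold gradientSpace; infer_instance

/-- The orthogonal projection onto the gradients of the form domain does not change the primitive on
the support of `ν`. -/
theorem inner_evalVec_orthogonalProjectionOnto {ν : Measure ℝ} {x : ℝ}
    (hx : x ∈ Set.Ioo (0 : ℝ) 1) (hs : x ∈ ν.support) {u : L2Unit} (hu : ⟪evalVec 1, u⟫_ℝ = 0) :
    ⟪evalVec x, ((gradientSpace ν).orthogonalProjectionOnto u : L2Unit)⟫_ℝ = ⟪evalVec x, u⟫_ℝ := by
  have hmem := sub_smul_evalVec_mem_gradientSpace hx hs
  -- For primitives vanishing at `1`, evaluation at `x` is represented by the Green vector, which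
  -- lies in the gradient space and so does not see the projection.
  have h1 : ∀ w : L2Unit, ⟪evalVec 1, w⟫_ℝ = 0 →
      ⟪evalVec x, w⟫_ℝ = ⟪evalVec x - x • evalVec 1, w⟫_ℝ := fun w hw => by
    rw [inner_sub_left, real_inner_smul_left, hw, mul_zero, sub_zero]
  rw [h1 u hu, h1 _ (mem_gradientSpace_iff.1 (Subtype.property _)).1]
  have := Submodule.inner_orthogonalProjectionOnto_eq_of_mem_left
    (⟨_, hmem⟩ : gradientSpace ν) u
  exact this

/-! ### The operator of the mass form and its eigenvalues -/

/-- The operator on the gradient space whose form is `(u, v) ↦ ∫ f g dν`, where `f` and `g` are the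
primitives of `u` and `v`. -/
noncomputable def formOperator (ν : Measure ℝ) : gradientSpace ν →L[ℝ] gradientSpace ν :=
  kernelOperator ν fun y => (gradientSpace ν).orthogonalProjectionOnto (evalVec y)

section FormOperator

variable {ν : Measure ℝ}

theorem continuous_proj_evalVec :
    Continuous fun y => (gradientSpace ν).orthogonalProjectionOnto (evalVec y) :=
  (ContinuousLinearMap.continuous _).comp continuous_evalVec

theorem norm_proj_evalVec_le (y : ℝ) :
    ‖(gradientSpace ν).orthogonalProjectionOnto (evalVec y)‖ ≤ 1 :=
  ((gradientSpace ν).norm_orthogonalProjectionOnto_apply_le _).trans (norm_evalVec_le y)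

variable [IsFiniteMeasure ν]

theorem formOperator_isCompact : IsCompactOperator (formOperator ν) :=
  kernelOperator_isCompact continuous_proj_evalVec norm_proj_evalVec_le

theorem formOperator_isSymmetric : (formOperator ν).IsSymmetric :=
  kernelOperator_isSymmetric continuous_proj_evalVec norm_proj_evalVec_le

theorem inner_formOperator (u v : gradientSpace ν) :
    ⟪formOperator ν u, v⟫_ℝ = ∫ y, ⟪evalVec y, (u : L2Unit)⟫_ℝ * ⟪evalVec y, (v : L2Unit)⟫_ℝ ∂ν := by
  rw [formOperator, inner_kernelOperator continuous_proj_evalVec norm_proj_evalVec_le]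
  simp only [Submodule.inner_orthogonalProjectionOnto_eq_of_mem_right]

theorem formOperator_nonneg (u : gradientSpace ν) : 0 ≤ ⟪formOperator ν u, u⟫_ℝ := by
  rw [inner_formOperator]
  exact integral_nonneg fun y => mul_self_nonneg _

theorem isEigenfunction_primitive (hν : ν (Set.Ioo (0 : ℝ) 1)ᶜ = 0) {u : gradientSpace ν}
    (hu0 : u ≠ 0) {r : ℝ} (hr : r ≠ 0) (hu : formOperator ν u = r • u) :
    IsEigenfunction ν r⁻¹ (primitive u) := by
  have hu1 := (mem_gradientSpace_iff.1 u.2).1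
  refine ⟨primitive_mem_formDomain u.2, fun h => hu0 (Subtype.ext (primitive_injOn hu1 h)),
    fun g hg => ?_⟩
  obtain ⟨v, hv, hgv, hval⟩ := exists_gradient_of_mem_formDomain hg
  rw [energy_eq_inner (weakDeriv_primitive u.2) hgv]
  have h1 : ⟪formOperator ν u, (⟨v, hv⟩ : gradientSpace ν)⟫_ℝ = ∫ y, primitive u y * g y ∂ν := by
    rw [inner_formOperator]
    have hae : ∀ᵐ y ∂ν, y ∈ Set.Ioo (0 : ℝ) 1 := hν
    refine integral_congr_ae (hae.mono fun y hy => ?_)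
    have hy' : y ∈ Set.Icc (0 : ℝ) 1 := ⟨hy.1.le, hy.2.le⟩
    simp only [primitive_apply hu1 hy', hval y hy']
  rw [← h1, hu, Submodule.coe_inner, Submodule.coe_smul, real_inner_smul_left,
    inv_mul_cancel_left₀ hr]

/-- Eigenvectors of `formOperator ν` with large eigenvalues yield eigenfunctions of the form. -/
theorem rank_topEigenspan_le_eigenvalueCount (hν : ν (Set.Ioo (0 : ℝ) 1)ᶜ = 0) {x : ℝ}
    (hx : 0 < x) :
    Cardinal.toENat (Module.rank ℝ (topEigenspan (formOperator ν) x⁻¹)) ≤ eigenvalueCount ν x := by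
  rw [eigenvalueCount]
  let Φ : gradientSpace ν →ₗ[ℝ] (ℝ → ℝ) := primitive ∘ₗ (gradientSpace ν).subtype
  have hΦ : Function.Injective Φ := by
    rw [← LinearMap.ker_eq_bot, LinearMap.ker_eq_bot']
    intro u hu
    exact Subtype.ext (primitive_injOn (mem_gradientSpace_iff.1 u.2).1 hu)
  have hmap : (topEigenspan (formOperator ν) x⁻¹).map Φ ≤
      Submodule.span ℝ {f : ℝ → ℝ | ∃ μ ≤ x, IsEigenfunction ν μ f} := by
    rw [topEigenspan, Submodule.map_span, Submodule.span_le]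
    rintro _ ⟨u, ⟨r, hr, hu⟩, rfl⟩
    by_cases hu0 : u = 0
    · rw [hu0, map_zero]
      exact Submodule.zero_mem _
    · have hr0 : 0 < r := (inv_pos.2 hx).trans_le hr
      exact Submodule.subset_span
        ⟨r⁻¹, inv_le_of_inv_le₀ hx hr, isEigenfunction_primitive hν hu0 hr0.ne' hu⟩
  refine Cardinal.toENat.monotone' ?_
  calc Module.rank ℝ (topEigenspan (formOperator ν) x⁻¹)
      ≤ Module.rank ℝ ((topEigenspan (formOperator ν) x⁻¹).map Φ) := by
        have := (Submodule.equivMapOfInjective Φ hΦ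
          (topEigenspan (formOperator ν) x⁻¹)).lift_rank_eq
        simpa using this.le
    _ ≤ _ := Submodule.rank_mono hmap

/-- A family of trial functions bounds the eigenvalue counting function from below. -/
theorem card_le_eigenvalueCount (hν : ν (Set.Ioo (0 : ℝ) 1)ᶜ = 0) {x : ℝ} (hx : 0 < x)
    {ι : Type*} [Fintype ι] (h : ι → L2Unit) (h1 : ∀ i, ⟪evalVec 1, h i⟫_ℝ = 0)
    (hE : ∀ c : ι → ℝ, c ≠ 0 →
      ‖∑ i, c i • h i‖ ^ 2 < x * ∫ y, ⟪evalVec y, ∑ i, c i • h i⟫_ℝ ^ 2 ∂ν) :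
    (Fintype.card ι : ℕ∞) ≤ eigenvalueCount ν x := by
  refine le_trans ?_ (rank_topEigenspan_le_eigenvalueCount hν hx)
  let P := (gradientSpace ν).orthogonalProjectionOnto
  refine card_le_rank_topEigenspan formOperator_isCompact formOperator_isSymmetric
    formOperator_nonneg (inv_pos.2 hx).le
    ((P : L2Unit →ₗ[ℝ] gradientSpace ν) ∘ₗ Fintype.linearCombination ℝ h) fun c hc => ?_
  have hsum : Fintype.linearCombination ℝ h c = ∑ i, c i • h i :=
    Fintype.linearCombination_apply ℝ h c
  rw [LinearMap.comp_apply, hsum]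
  change x⁻¹ * ‖P (∑ i, c i • h i)‖ ^ 2 <
    ⟪formOperator ν (P (∑ i, c i • h i)), P (∑ i, c i • h i)⟫_ℝ
  have hz : ⟪evalVec 1, ∑ i, c i • h i⟫_ℝ = 0 := by
    rw [inner_sum]
    exact Finset.sum_eq_zero fun i _ => by rw [inner_smul_right, h1, mul_zero]
  -- Trial functions need not be affine off the support: projecting keeps their values `ν`-almost
  -- everywhere and does not increase the energy.
  have hint : ⟪formOperator ν (P (∑ i, c i • h i)), P (∑ i, c i • h i)⟫_ℝ =
      ∫ y, ⟪evalVec y, ∑ i, c i • h i⟫_ℝ ^ 2 ∂ν := by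
    rw [inner_formOperator]
    have hae : ∀ᵐ y ∂ν, y ∈ Set.Ioo (0 : ℝ) 1 := hν
    have hs : ∀ᵐ y ∂ν, y ∈ ν.support := Measure.support_mem_ae
    refine integral_congr_ae ?_
    filter_upwards [hae, hs] with y hy hys
    rw [inner_evalVec_orthogonalProjectionOnto hy hys hz, sq]
  rw [hint, inv_mul_lt_iff₀ hx]
  refine lt_of_le_of_lt ?_ (hE c hc)
  gcongr
  exact (gradientSpace ν).norm_orthogonalProjectionOnto_apply_le _

end FormOperator

/-! ### Trapezoidal trial functions -/

/-- The gradient of the trapezoidal function which is `1` on `[k 2⁻ⁿ, (k+1) 2⁻ⁿ]` and vanishes off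
`[(k-1) 2⁻ⁿ, (k+2) 2⁻ⁿ]`. -/
noncomputable def trapezoid (n k : ℕ) : L2Unit :=
  (2 ^ n : ℝ) • (evalVec (k / 2 ^ n) - evalVec ((k - 1) / 2 ^ n) - evalVec ((k + 2) / 2 ^ n)
    + evalVec ((k + 1) / 2 ^ n))

/-- The trapezoidal function on the integer scale. -/
noncomputable def trapezoidFun (k : ℕ) (z : ℝ) : ℝ :=
  min z k - min z (k - 1) - min z (k + 2) + min z (k + 1)

theorem inner_evalVec_trapezoid {n k : ℕ} (hk : 1 ≤ k) (hk' : k + 2 ≤ 2 ^ n) {z : ℝ}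
    (hz : 0 ≤ z) (hz' : z ≤ 2 ^ n) :
    ⟪evalVec (z / 2 ^ n), trapezoid n k⟫_ℝ = trapezoidFun k z := by
  have hp : (0 : ℝ) < 2 ^ n := by positivity
  have hk1 : (1 : ℝ) ≤ k := by exact_mod_cast hk
  have hk2 : (k : ℝ) + 2 ≤ 2 ^ n := by exact_mod_cast hk'
  have hmem : ∀ w : ℝ, 0 ≤ w → w ≤ 2 ^ n → w / 2 ^ n ∈ Set.Icc (0 : ℝ) 1 := fun w h0 h1 =>
    ⟨by positivity, (div_le_one hp).2 h1⟩
  have hmin : ∀ w : ℝ, 0 ≤ w → w ≤ 2 ^ n →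
      2 ^ n * ⟪evalVec (z / 2 ^ n), evalVec (w / 2 ^ n)⟫_ℝ = min z w := fun w h0 h1 => by
    rw [inner_evalVec_of_mem (hmem z hz hz') (hmem w h0 h1), min_div_div_right hp.le]
    field_simp
  rw [trapezoid, inner_smul_right, inner_add_right, inner_sub_right, inner_sub_right, mul_add,
    mul_sub, mul_sub, hmin _ (by linarith) (by linarith), hmin _ (by linarith) (by linarith),
    hmin _ (by linarith) (by linarith), hmin _ (by linarith) (by linarith), trapezoidFun]

theorem trapezoidFun_eq_one {k : ℕ} {z : ℝ} (h : (k : ℝ) ≤ z) (h' : z ≤ k + 1) :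
    trapezoidFun k z = 1 := by
  rw [trapezoidFun, min_eq_right h, min_eq_right (by linarith), min_eq_left (by linarith),
    min_eq_left h']
  ring

theorem trapezoidFun_eq_zero {k : ℕ} {z : ℝ} (h : z ≤ k - 1 ∨ (k : ℝ) + 2 ≤ z) :
    trapezoidFun k z = 0 := by
  rw [trapezoidFun]
  rcases h with h | h
  · rw [min_eq_left (by linarith), min_eq_left h, min_eq_left (by linarith),
      min_eq_left (by linarith)]
    ring
  · rw [min_eq_right (by linarith), min_eq_right (by linarith), min_eq_right h,
      min_eq_right (by linarith)]
    ring

/-- One trapezoid gradient is a combination of evaluation vectors, so the pairing reads off the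
other trapezoid at the four kinks of the first. -/
theorem inner_trapezoid {n j k : ℕ} (hj : 1 ≤ j) (hj' : j + 2 ≤ 2 ^ n)
    (hk : 1 ≤ k) (hk' : k + 2 ≤ 2 ^ n) :
    ⟪trapezoid n j, trapezoid n k⟫_ℝ = 2 ^ n * (trapezoidFun k j - trapezoidFun k (j - 1)
      - trapezoidFun k (j + 2) + trapezoidFun k (j + 1)) := by
  have hj1 : (1 : ℝ) ≤ j := by exact_mod_cast hj
  have hj2 : (j : ℝ) + 2 ≤ 2 ^ n := by exact_mod_cast hj'
  rw [trapezoid, real_inner_smul_left, inner_add_left, inner_sub_left, inner_sub_left,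
    inner_evalVec_trapezoid hk hk' (by linarith) (by linarith),
    inner_evalVec_trapezoid hk hk' (by linarith) (by linarith),
    inner_evalVec_trapezoid hk hk' (by linarith) (by linarith),
    inner_evalVec_trapezoid hk hk' (by linarith) (by linarith)]

theorem inner_trapezoid_self {n k : ℕ} (hk : 1 ≤ k) (hk' : k + 2 ≤ 2 ^ n) :
    ⟪trapezoid n k, trapezoid n k⟫_ℝ = 2 * 2 ^ n := by
  rw [inner_trapezoid hk hk' hk hk', trapezoidFun_eq_one le_rfl (by linarith),
    trapezoidFun_eq_zero (Or.inl le_rfl), trapezoidFun_eq_zero (Or.inr le_rfl),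
    trapezoidFun_eq_one (by linarith) le_rfl]
  ring

/-- The supports extend one unit beyond the plateaus, so at index distance three they share at most
an endpoint. -/
theorem inner_trapezoid_of_dist {n j k : ℕ} (hj : 1 ≤ j) (hj' : j + 2 ≤ 2 ^ n)
    (hk : 1 ≤ k) (hk' : k + 2 ≤ 2 ^ n) (h : j + 3 ≤ k ∨ k + 3 ≤ j) :
    ⟪trapezoid n j, trapezoid n k⟫_ℝ = 0 := by
  rw [inner_trapezoid hj hj' hk hk']
  rcases h with h | h
  · have h' : (j : ℝ) + 3 ≤ k := by exact_mod_cast h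
    rw [trapezoidFun_eq_zero (Or.inl (by linarith)), trapezoidFun_eq_zero (Or.inl (by linarith)),
      trapezoidFun_eq_zero (Or.inl (by linarith)), trapezoidFun_eq_zero (Or.inl (by linarith))]
    ring
  · have h' : (k : ℝ) + 3 ≤ j := by exact_mod_cast h
    rw [trapezoidFun_eq_zero (Or.inr (by linarith)), trapezoidFun_eq_zero (Or.inr (by linarith)),
      trapezoidFun_eq_zero (Or.inr (by linarith)), trapezoidFun_eq_zero (Or.inr (by linarith))]
    ring

theorem measurableSet_dyadic (n k : ℕ) : MeasurableSet (dyadic n k) := measurableSet_Ioc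

theorem pairwise_disjoint_dyadic (n : ℕ) : Pairwise (Function.onFun Disjoint (dyadic n)) := by
  intro i j hij
  have hp : (0 : ℝ) < 2 ^ n := by positivity
  rw [Function.onFun, Set.disjoint_left]
  rintro y ⟨h1, h2⟩ ⟨h3, h4⟩
  rw [div_lt_iff₀ hp] at h1 h3
  rw [le_div_iff₀ hp] at h2 h4
  have h5 : (i : ℝ) < j + 1 := by linarith
  have h6 : (j : ℝ) < i + 1 := by linarith
  norm_cast at h5 h6
  omega

/-- Dyadic intervals with large mass yield small eigenvalues. -/
theorem card_le_eigenvalueCount_of_dyadic {ν : Measure ℝ} [IsFiniteMeasure ν]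
    (hν : ν (Set.Ioo (0 : ℝ) 1)ᶜ = 0) {n : ℕ} {s : Finset ℕ}
    (hs : ∀ k ∈ s, 1 ≤ k ∧ k + 2 ≤ 2 ^ n)
    (hsep : ∀ j ∈ s, ∀ k ∈ s, j ≠ k → j + 3 ≤ k ∨ k + 3 ≤ j) {m x : ℝ} (hm : 0 < m)
    (hsm : ∀ k ∈ s, m ≤ ν.real (dyadic n k)) (hx : 2 * 2 ^ n / m < x) :
    (s.card : ℕ∞) ≤ eigenvalueCount ν x := by
  have hp : (0 : ℝ) < 2 ^ n := by positivity
  have hx0 : 0 < x := lt_trans (by positivity) hx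
  rw [← Fintype.card_coe]
  refine card_le_eigenvalueCount hν hx0 (fun k : s => trapezoid n k) (fun k => ?_) fun c hc => ?_
  · have hk := hs k k.2
    have hk2 : ((k : ℕ) : ℝ) + 2 ≤ 2 ^ n := by exact_mod_cast hk.2
    have := inner_evalVec_trapezoid hk.1 hk.2 hp.le le_rfl
    rw [div_self hp.ne', trapezoidFun_eq_zero (Or.inr hk2)] at this
    exact this
  set w := ∑ k : s, c k • trapezoid n k with hw
  have hnorm : ‖w‖ ^ 2 = 2 * 2 ^ n * ∑ k, c k ^ 2 := by
    rw [← real_inner_self_eq_norm_sq, hw, sum_inner, Finset.mul_sum]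
    refine Finset.sum_congr rfl fun j _ => ?_
    rw [inner_sum, Finset.sum_eq_single j]
    · rw [inner_smul_right, real_inner_smul_left, inner_trapezoid_self (hs j j.2).1 (hs j j.2).2]
      ring
    · intro k _ hkj
      rw [inner_smul_right, real_inner_smul_left,
        inner_trapezoid_of_dist (hs j j.2).1 (hs j j.2).2 (hs k k.2).1 (hs k k.2).2
          (hsep j j.2 k k.2 fun h => hkj (Subtype.ext h.symm)), mul_zero, mul_zero]
    · simp
  -- By separation only the `j`-th trapezoid lives on the `j`-th interval, where it is `1`. Hence `∫
  -- f² dν ≥ m ∑ c²`, against energy `2·2ⁿ ∑ c²`.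
  have hval : ∀ j : s, ∀ y ∈ dyadic n j, ⟪evalVec y, w⟫_ℝ = c j := by
    intro j y hy
    obtain ⟨hy1, hy2⟩ := hy
    rw [div_lt_iff₀ hp] at hy1
    rw [le_div_iff₀ hp] at hy2
    have hj2 : ((j : ℕ) : ℝ) + 2 ≤ 2 ^ n := by exact_mod_cast (hs j j.2).2
    have hj0 : (0 : ℝ) ≤ (j : ℕ) := Nat.cast_nonneg _
    have hyd : y = y * 2 ^ n / 2 ^ n := by field_simp
    have hk : ∀ k : s, ⟪evalVec y, trapezoid n k⟫_ℝ = trapezoidFun k (y * 2 ^ n) := fun k => by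
      conv_lhs => rw [hyd]
      exact inner_evalVec_trapezoid (hs k k.2).1 (hs k k.2).2 (by linarith) (by linarith)
    rw [hw, inner_sum, Finset.sum_eq_single j]
    · rw [inner_smul_right, hk, trapezoidFun_eq_one hy1.le hy2, mul_one]
    · intro k _ hkj
      rw [inner_smul_right, hk, trapezoidFun_eq_zero, mul_zero]
      rcases hsep j j.2 k k.2 fun h => hkj (Subtype.ext h.symm) with h | h
      · have h' : ((j : ℕ) : ℝ) + 3 ≤ (k : ℕ) := by exact_mod_cast h
        left; linarith
      · have h' : ((k : ℕ) : ℝ) + 3 ≤ (j : ℕ) := by exact_mod_cast h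
        right; linarith
    · simp
  have hint : Integrable (fun y => ⟪evalVec y, w⟫_ℝ ^ 2) ν := by
    refine Integrable.of_bound (by
      exact ((continuous_evalVec.inner continuous_const).pow 2).aestronglyMeasurable)
      (‖w‖ ^ 2) (Eventually.of_forall fun y => ?_)
    rw [norm_pow]
    gcongr
    calc ‖⟪evalVec y, w⟫_ℝ‖ ≤ ‖evalVec y‖ * ‖w‖ := norm_inner_le_norm _ _
      _ ≤ 1 * ‖w‖ := by gcongr; exact norm_evalVec_le y
      _ = ‖w‖ := one_mul _
  have hlow : m * ∑ k, c k ^ 2 ≤ ∫ y, ⟪evalVec y, w⟫_ℝ ^ 2 ∂ν := by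
    calc m * ∑ k, c k ^ 2 ≤ ∑ k : s, ∫ y in dyadic n k, ⟪evalVec y, w⟫_ℝ ^ 2 ∂ν := by
          rw [Finset.mul_sum]
          refine Finset.sum_le_sum fun k _ => ?_
          rw [setIntegral_congr_fun (g := fun _ => c k ^ 2) (measurableSet_dyadic n k)
            fun y hy => by simp only [hval k y hy], setIntegral_const, smul_eq_mul]
          exact mul_le_mul_of_nonneg_right (hsm k k.2) (sq_nonneg _)
      _ = ∫ y in ⋃ k : s, dyadic n k, ⟪evalVec y, w⟫_ℝ ^ 2 ∂ν := by
          rw [integral_iUnion_fintype (s := fun k : s => dyadic n k)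
            (fun k => measurableSet_dyadic n k) (fun i j hij =>
              pairwise_disjoint_dyadic n fun h => hij (Subtype.ext h)) fun _ => hint.integrableOn]
      _ ≤ _ := setIntegral_le_integral hint (Eventually.of_forall fun y => sq_nonneg _)
  have hcpos : 0 < ∑ k, c k ^ 2 := by
    obtain ⟨k, hk⟩ := Function.ne_iff.1 hc
    exact Finset.sum_pos' (fun _ _ => sq_nonneg _) ⟨k, Finset.mem_univ _, by
      have : c k ≠ 0 := hk
      positivity⟩
  rw [hnorm]
  rw [div_lt_iff₀ hm] at hx
  calc 2 * 2 ^ n * ∑ k, c k ^ 2 < x * m * ∑ k, c k ^ 2 := by gcongr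
    _ = x * (m * ∑ k, c k ^ 2) := by ring
    _ ≤ _ := by gcongr

/-! ### Partition functions and the `L^q`-spectrum -/

section Dyadic

open Classical in
/-- The indices of the dyadic intervals of generation `n` charged by `ν`. -/
noncomputable def chargedDyadic (ν : Measure ℝ) (n : ℕ) : Finset ℕ :=
  (Finset.range (2 ^ n)).filter (fun k => 0 < ν (dyadic n k))

/-- The partition function `∑ ν(C)^t`. -/
noncomputable def dyadicSum (ν : Measure ℝ) (n : ℕ) (t : ℝ) : ℝ :=
  ∑ k ∈ chargedDyadic ν n, ν.real (dyadic n k) ^ t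

theorem lqSpectrumAt_eq (ν : Measure ℝ) (n : ℕ) (t : ℝ) :
    lqSpectrumAt ν n t = Real.log (dyadicSum ν n t) / (n * Real.log 2) := by
  rw [← Real.log_pow, div_eq_inv_mul, ← one_div]
  rfl

variable {ν : Measure ℝ} [IsFiniteMeasure ν]

theorem measureReal_pos_of_mem {n k : ℕ} (hk : k ∈ chargedDyadic ν n) :
    0 < ν.real (dyadic n k) := by
  classical
  exact ENNReal.toReal_pos (Finset.mem_filter.1 hk).2.ne' (measure_ne_top _ _)

theorem biUnion_dyadic (n : ℕ) : ⋃ k ∈ Finset.range (2 ^ n), dyadic n k = Set.Ioc (0 : ℝ) 1 := by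
  have hp : (0 : ℝ) < 2 ^ n := by positivity
  ext y
  simp only [Set.mem_iUnion, Finset.mem_range, exists_prop, dyadic, Set.mem_Ioc,
    div_lt_iff₀ hp, le_div_iff₀ hp]
  constructor
  · rintro ⟨k, hk, h1, h2⟩
    have hk' : (k : ℝ) + 1 ≤ 2 ^ n := by exact_mod_cast hk
    constructor
    · have : (0 : ℝ) ≤ k := Nat.cast_nonneg k
      exact pos_of_mul_pos_left (lt_of_le_of_lt this h1) hp.le
    · exact le_of_mul_le_mul_right (by linarith) hp
  · rintro ⟨h0, h1⟩
    have hpos : 0 < y * 2 ^ n := by positivity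
    have hc : 0 < ⌈y * 2 ^ n⌉₊ := Nat.ceil_pos.2 hpos
    have hcast : ((⌈y * 2 ^ n⌉₊ - 1 : ℕ) : ℝ) = (⌈y * 2 ^ n⌉₊ : ℝ) - 1 := by
      rw [Nat.cast_sub hc, Nat.cast_one]
    -- The intervals are open on the left, so the index is the ceiling minus one, not the floor.
    refine ⟨⌈y * 2 ^ n⌉₊ - 1, ?_, ?_, ?_⟩
    · have : ⌈y * 2 ^ n⌉₊ ≤ 2 ^ n := Nat.ceil_le.2 (by push_cast; nlinarith)
      omega
    · rw [hcast]
      linarith [Nat.ceil_lt_add_one hpos.le]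
    · rw [hcast]
      linarith [Nat.le_ceil (y * 2 ^ n)]

theorem sum_chargedDyadic (hν : ν (Set.Ioo (0 : ℝ) 1)ᶜ = 0) (n : ℕ) :
    ∑ k ∈ chargedDyadic ν n, ν.real (dyadic n k) = ν.real Set.univ := by
  classical
  have h1 : ∑ k ∈ chargedDyadic ν n, ν.real (dyadic n k) =
      ∑ k ∈ Finset.range (2 ^ n), ν.real (dyadic n k) := by
    refine Finset.sum_subset (Finset.filter_subset _ _) fun k hk hk' => ?_
    have : ν (dyadic n k) = 0 := by
      by_contra h
      exact hk' (Finset.mem_filter.2 ⟨hk, pos_iff_ne_zero.2 h⟩)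
    rw [measureReal_def, this, ENNReal.toReal_zero]
  rw [h1, ← measureReal_biUnion_finset ((pairwise_disjoint_dyadic n).set_pairwise _)
    fun k _ => measurableSet_dyadic n k, biUnion_dyadic, measureReal_def, measureReal_def]
  congr 1
  exact measure_congr (ae_eq_univ.2 (measure_mono_null
    (Set.compl_subset_compl.2 Set.Ioo_subset_Ioc_self) hν))

theorem measureReal_univ_pos (hν0 : ν ≠ 0) : 0 < ν.real Set.univ :=
  ENNReal.toReal_pos (by simpa using hν0) (measure_ne_top _ _)

theorem dyadicSum_pos (hν : ν (Set.Ioo (0 : ℝ) 1)ᶜ = 0) (hν0 : ν ≠ 0) (n : ℕ) (t : ℝ) :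
    0 < dyadicSum ν n t := by
  refine Finset.sum_pos (fun k hk => Real.rpow_pos_of_pos (measureReal_pos_of_mem hk) _) ?_
  by_contra h
  have h1 := sum_chargedDyadic hν n
  rw [Finset.not_nonempty_iff_eq_empty.1 h, Finset.sum_empty] at h1
  exact (measureReal_univ_pos hν0).ne h1

theorem rpow_lqSpectrumAt (hν : ν (Set.Ioo (0 : ℝ) 1)ᶜ = 0) (hν0 : ν ≠ 0) {n : ℕ} (hn : 1 ≤ n)
    (t : ℝ) : (2 : ℝ) ^ (n * lqSpectrumAt ν n t) = dyadicSum ν n t := by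
  have hn' : (n : ℝ) ≠ 0 := by positivity
  have hl : Real.log 2 ≠ 0 := (Real.log_pos one_lt_two).ne'
  rw [lqSpectrumAt_eq, Real.rpow_def_of_pos two_pos]
  have : Real.log 2 * (n * (Real.log (dyadicSum ν n t) / (n * Real.log 2))) =
      Real.log (dyadicSum ν n t) := by field_simp
  rw [this, Real.exp_log (dyadicSum_pos hν hν0 n t)]

theorem eventually_dyadicSum_le (hν : ν (Set.Ioo (0 : ℝ) 1)ᶜ = 0) (hν0 : ν ≠ 0) {t r : ℝ}
    (h : lqSpectrum ν t < r) : ∀ᶠ n : ℕ in atTop, dyadicSum ν n t ≤ (2 : ℝ) ^ (n * r) := by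
  filter_upwards [eventually_lt_of_limsup_lt h, eventually_ge_atTop 1] with n hn hn1
  rw [← rpow_lqSpectrumAt hν hν0 hn1]
  have : lqSpectrumAt ν n t < r := by exact_mod_cast hn
  exact Real.rpow_le_rpow_of_exponent_le one_le_two (by gcongr)

/-- A limsup controls all large `n` only from above; the lower bound is where convergence of
`β_n(q)` enters. -/
theorem eventually_le_dyadicSum (hν : ν (Set.Ioo (0 : ℝ) 1)ᶜ = 0) (hν0 : ν ≠ 0) {t r : ℝ}
    (hlim : Tendsto (fun n : ℕ => (lqSpectrumAt ν n t : EReal)) atTop (𝓝 (lqSpectrum ν t)))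
    (h : r < lqSpectrum ν t) : ∀ᶠ n : ℕ in atTop, (2 : ℝ) ^ (n * r) ≤ dyadicSum ν n t := by
  filter_upwards [hlim.eventually_const_lt h, eventually_ge_atTop 1] with n hn hn1
  rw [← rpow_lqSpectrumAt hν hν0 hn1]
  have : r < lqSpectrumAt ν n t := by exact_mod_cast hn
  exact Real.rpow_le_rpow_of_exponent_le one_le_two (by gcongr)

theorem measureReal_dyadic_le (n k : ℕ) : ν.real (dyadic n k) ≤ max 1 (ν.real Set.univ) :=
  (measureReal_mono (Set.subset_univ _)).trans (le_max_right _ _)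

/-- Split off one factor `ν(C)`, which sums to the total mass, and bound the remaining power
uniformly. The maximum with `1` is there because `ν` is not normalised. -/
theorem dyadicSum_le_of_one_le (hν : ν (Set.Ioo (0 : ℝ) 1)ᶜ = 0) {t : ℝ} (ht : 1 ≤ t) (n : ℕ) :
    dyadicSum ν n t ≤ max 1 (ν.real Set.univ) ^ t := by
  have hC : 0 < max 1 (ν.real Set.univ) := lt_max_of_lt_left one_pos
  calc dyadicSum ν n t
      ≤ ∑ k ∈ chargedDyadic ν n, ν.real (dyadic n k) * max 1 (ν.real Set.univ) ^ (t - 1) := by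
        refine Finset.sum_le_sum fun k hk => ?_
        have hpos := measureReal_pos_of_mem hk
        calc ν.real (dyadic n k) ^ t
            = ν.real (dyadic n k) * ν.real (dyadic n k) ^ (t - 1) := by
              rw [Real.rpow_sub_one hpos.ne']; field_simp
          _ ≤ _ := by
              gcongr
              exact measureReal_dyadic_le n k
    _ ≤ max 1 (ν.real Set.univ) * max 1 (ν.real Set.univ) ^ (t - 1) := by
        rw [← Finset.sum_mul, sum_chargedDyadic hν n]
        gcongr
        exact le_max_right _ _
    _ = max 1 (ν.real Set.univ) ^ t := by rw [Real.rpow_sub_one hC.ne']; field_simp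

theorem lqSpectrum_nonpos (hν : ν (Set.Ioo (0 : ℝ) 1)ᶜ = 0) (hν0 : ν ≠ 0) {t : ℝ} (ht : 1 ≤ t) :
    lqSpectrum ν t ≤ 0 := by
  set C := Real.log (max 1 (ν.real Set.univ) ^ t) with hC
  have hl : 0 < Real.log 2 := Real.log_pos one_lt_two
  have hle : ∀ n : ℕ, (lqSpectrumAt ν n t : EReal) ≤ ((C / (n * Real.log 2) : ℝ) : EReal) := by
    intro n
    rw [EReal.coe_le_coe_iff, lqSpectrumAt_eq]
    gcongr
    exact Real.log_le_log (dyadicSum_pos hν hν0 n t) (dyadicSum_le_of_one_le hν ht n)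
  have hlim : Tendsto (fun n : ℕ => ((C / (n * Real.log 2) : ℝ) : EReal)) atTop
      (𝓝 ((0 : ℝ) : EReal)) := by
    refine (continuous_coe_real_ereal.tendsto 0).comp ?_
    exact Tendsto.const_div_atTop (tendsto_natCast_atTop_atTop.atTop_mul_const hl) C
  calc lqSpectrum ν t ≤ limsup (fun n : ℕ => ((C / (n * Real.log 2) : ℝ) : EReal)) atTop :=
        limsup_le_limsup (Eventually.of_forall hle)
    _ = 0 := by rw [hlim.limsup_eq]; rfl

/-- For such `q` the partition function lies between a positive constant and a constant times `2ⁿ`.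
-/
theorem exists_lqSpectrum_eq_coe (hν : ν (Set.Ioo (0 : ℝ) 1)ᶜ = 0) (hν0 : ν ≠ 0) {q : ℝ}
    (hq : q ∈ Set.Icc (0 : ℝ) 1) : ∃ B : ℝ, lqSpectrum ν q = B := by
  have hl : 0 < Real.log 2 := Real.log_pos one_lt_two
  set C := max 1 (ν.real Set.univ) with hC
  have hC1 : 1 ≤ C := le_max_left _ _
  have hM := measureReal_univ_pos hν0
  have hup : ∀ n, dyadicSum ν n q ≤ 2 ^ n * C := by
    intro n
    classical
    calc dyadicSum ν n q ≤ ∑ k ∈ chargedDyadic ν n, C := by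
          refine Finset.sum_le_sum fun k hk => ?_
          calc ν.real (dyadic n k) ^ q ≤ C ^ q :=
                Real.rpow_le_rpow measureReal_nonneg (measureReal_dyadic_le n k) hq.1
            _ ≤ C ^ (1 : ℝ) := Real.rpow_le_rpow_of_exponent_le hC1 hq.2
            _ = C := Real.rpow_one C
      _ = (chargedDyadic ν n).card * C := by rw [Finset.sum_const, nsmul_eq_mul]
      _ ≤ 2 ^ n * C := by
          gcongr
          have : (chargedDyadic ν n).card ≤ 2 ^ n :=
            (Finset.card_filter_le _ _).trans (Finset.card_range _).le
          exact_mod_cast this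
  have hlow : ∀ n, ν.real Set.univ / C ≤ dyadicSum ν n q := by
    intro n
    rw [div_le_iff₀ (by linarith), ← sum_chargedDyadic hν n, dyadicSum, Finset.sum_mul]
    refine Finset.sum_le_sum fun k hk => ?_
    have hpos := measureReal_pos_of_mem hk
    calc ν.real (dyadic n k) = ν.real (dyadic n k) ^ q * ν.real (dyadic n k) ^ (1 - q) := by
          rw [← Real.rpow_add hpos]; simp
      _ ≤ ν.real (dyadic n k) ^ q * C ^ (1 - q) := by
          gcongr
          · linarith [hq.2]
          · exact measureReal_dyadic_le n k
      _ ≤ ν.real (dyadic n k) ^ q * C := by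
          gcongr
          calc C ^ (1 - q) ≤ C ^ (1 : ℝ) :=
                Real.rpow_le_rpow_of_exponent_le hC1 (by linarith [hq.1])
            _ = C := Real.rpow_one C
  have h1 : lqSpectrum ν q ≤ ((1 + Real.log C / Real.log 2 : ℝ) : EReal) := by
    refine limsup_le_of_le (by isBoundedDefault) ?_
    filter_upwards [eventually_ge_atTop 1] with n hn
    have hn' : (1 : ℝ) ≤ n := by exact_mod_cast hn
    rw [EReal.coe_le_coe_iff, lqSpectrumAt_eq, div_le_iff₀ (by positivity)]
    have h2 := Real.log_le_log (dyadicSum_pos hν hν0 n q) (hup n)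
    rw [Real.log_mul (by positivity) (by positivity), Real.log_pow] at h2
    have h3 : 0 ≤ Real.log C := Real.log_nonneg hC1
    have h4 : (1 + Real.log C / Real.log 2) * (n * Real.log 2) =
        n * Real.log 2 + n * Real.log C := by field_simp
    rw [h4]
    nlinarith
  have h2 : ((-(|Real.log (ν.real Set.univ / C)| / Real.log 2) : ℝ) : EReal) ≤ lqSpectrum ν q := by
    refine le_limsup_of_frequently_le (Eventually.frequently ?_) (by isBoundedDefault)
    filter_upwards [eventually_ge_atTop 1] with n hn
    have hn' : (1 : ℝ) ≤ n := by exact_mod_cast hn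
    rw [EReal.coe_le_coe_iff, lqSpectrumAt_eq, le_div_iff₀ (by positivity)]
    have h2 := Real.log_le_log (by positivity) (hlow n)
    have h3 := neg_abs_le (Real.log (ν.real Set.univ / C))
    have h4 : -(|Real.log (ν.real Set.univ / C)| / Real.log 2) * (n * Real.log 2) =
        -(n * |Real.log (ν.real Set.univ / C)|) := by field_simp
    rw [h4]
    nlinarith [abs_nonneg (Real.log (ν.real Set.univ / C))]
  refine ⟨(lqSpectrum ν q).toReal, (EReal.coe_toReal ?_ ?_).symm⟩
  · intro h
    rw [h] at h1
    exact absurd h1 (not_le.2 (EReal.coe_lt_top _))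
  · intro h
    rw [h] at h2
    exact absurd h2 (not_le.2 (EReal.bot_lt_coe _))

/-- The spectrum is nonpositive on `[1,∞)`, so no supporting line can have positive slope. This
makes `1 + b` positive in the main theorem. -/
theorem nonneg_of_neg_mem_lqSubdifferential (hν : ν (Set.Ioo (0 : ℝ) 1)ᶜ = 0) (hν0 : ν ≠ 0)
    {q B s : ℝ} (hB : lqSpectrum ν q = B) (hs : -s ∈ lqSubdifferential ν q) : 0 ≤ s := by
  have h : ∀ t : ℝ, 1 ≤ t → -s * (t - q) + B ≤ 0 := fun t ht => by
    have := (hs t).trans (lqSpectrum_nonpos hν hν0 ht)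
    rw [hB] at this
    exact_mod_cast this
  by_contra! hneg
  have h1 := h (max 1 (q + (|B| + 1) / (-s))) (le_max_left _ _)
  have h2 : (|B| + 1) / (-s) ≤ max 1 (q + (|B| + 1) / (-s)) - q := by
    linarith [le_max_right 1 (q + (|B| + 1) / (-s))]
  rw [div_le_iff₀ (by linarith)] at h2
  linarith [neg_abs_le B]

/-- If `s` lies off the subdifferential because of `t`, then the intervals which are too large or too
small for the exponent `s` contribute exponentially little to the partition function. -/
theorem exists_tail_bound (hν : ν (Set.Ioo (0 : ℝ) 1)ᶜ = 0) (hν0 : ν ≠ 0) {q B s t : ℝ}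
    (h : lqSpectrum ν t < ((-s * (t - q) + B : ℝ) : EReal)) :
    ∃ e < B, ∀ᶠ n : ℕ in atTop, ∀ A ⊆ chargedDyadic ν n,
      (∀ k ∈ A, ν.real (dyadic n k) ^ (q - t) ≤ ((2 : ℝ) ^ (-(n * s))) ^ (q - t)) →
      ∑ k ∈ A, ν.real (dyadic n k) ^ q ≤ (2 : ℝ) ^ (n * e) := by
  obtain ⟨r, hr1, hr2⟩ := EReal.lt_iff_exists_real_btwn.1 h
  rw [EReal.coe_lt_coe_iff] at hr2
  -- Chernoff bound: `p^q = p^t p^(q-t)`, with the last factor replaced by its value at `p =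
  -- 2^{-ns}`. For `t > q` the condition on `A` selects large masses, for `t < q` small ones.
  refine ⟨r + s * (t - q), by linarith, ?_⟩
  filter_upwards [eventually_dyadicSum_le hν hν0 hr1] with n hn A hA hk
  calc ∑ k ∈ A, ν.real (dyadic n k) ^ q
      ≤ ∑ k ∈ A, ν.real (dyadic n k) ^ t * ((2 : ℝ) ^ (-(n * s))) ^ (q - t) := by
        refine Finset.sum_le_sum fun k hkA => ?_
        have hpos := measureReal_pos_of_mem (hA hkA)
        calc ν.real (dyadic n k) ^ q = ν.real (dyadic n k) ^ t * ν.real (dyadic n k) ^ (q - t) := by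
              rw [← Real.rpow_add hpos]; simp
          _ ≤ _ := mul_le_mul_of_nonneg_left (hk k hkA) (Real.rpow_nonneg hpos.le _)
    _ ≤ dyadicSum ν n t * ((2 : ℝ) ^ (-(n * s))) ^ (q - t) := by
        rw [← Finset.sum_mul]
        gcongr
        exact Finset.sum_le_sum_of_subset_of_nonneg hA fun k _ _ =>
          Real.rpow_nonneg measureReal_nonneg _
    _ ≤ (2 : ℝ) ^ (n * r) * ((2 : ℝ) ^ (-(n * s))) ^ (q - t) := by gcongr
    _ = (2 : ℝ) ^ (n * (r + s * (t - q))) := by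
        rw [← Real.rpow_mul two_pos.le, ← Real.rpow_add two_pos]
        congr 1
        ring

theorem tendsto_two_rpow_mul {c : ℝ} (hc : 0 < c) :
    Tendsto (fun n : ℕ => (2 : ℝ) ^ (n * c)) atTop atTop := by
  have : ∀ n : ℕ, (2 : ℝ) ^ (n * c) = ((2 : ℝ) ^ c) ^ n := fun n => by
    rw [mul_comm, Real.rpow_mul two_pos.le, Real.rpow_natCast]
  simp_rw [this]
  exact tendsto_pow_atTop_atTop_of_one_lt (Real.one_lt_rpow one_lt_two hc)

/-- There are many dyadic intervals of mass about `2^{-nb}`. -/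
theorem eventually_exists_many_dyadic (hν : ν (Set.Ioo (0 : ℝ) 1)ᶜ = 0) (hν0 : ν ≠ 0)
    {q B a b : ℝ} (hq : q ∈ Set.Icc (0 : ℝ) 1) (hB : lqSpectrum ν q = B)
    (hlim : Tendsto (fun n : ℕ => (lqSpectrumAt ν n q : EReal)) atTop (𝓝 (lqSpectrum ν q)))
    (ha : -a ∈ lqSubdifferential ν q) (hb : -b ∈ lqSubdifferential ν q)
    (ha' : ∀ s < a, -s ∉ lqSubdifferential ν q) (hb' : ∀ s > b, -s ∉ lqSubdifferential ν q)
    {ε : ℝ} (hε : 0 < ε) :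
    ∀ᶠ n : ℕ in atTop, ∃ G ⊆ Finset.range (2 ^ n),
      (∀ k ∈ G, (2 : ℝ) ^ (-(n * (b + ε))) ≤ ν.real (dyadic n k)) ∧
      2⁻¹ * (2 : ℝ) ^ (n * (a * q + B - 2 * ε)) ≤ G.card := by
  classical
  have hex : ∀ s, -s ∉ lqSubdifferential ν q →
      ∃ t : ℝ, lqSpectrum ν t < ((-s * (t - q) + B : ℝ) : EReal) := by
    intro s hs
    simp only [lqSubdifferential, Set.mem_ofPred_eq, not_forall, not_le, hB] at hs
    exact_mod_cast hs
  have hmem : ∀ s, -s ∈ lqSubdifferential ν q → ∀ t : ℝ,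
      ((-s * (t - q) + B : ℝ) : EReal) ≤ lqSpectrum ν t := by
    intro s hs t
    have := hs t
    rw [hB] at this
    exact_mod_cast this
  obtain ⟨t₁, ht₁⟩ := hex (a - ε) (ha' _ (by linarith))
  obtain ⟨t₂, ht₂⟩ := hex (b + ε) (hb' _ (by linarith))
  -- The line of slope `-a` lies below the spectrum and the steeper or flatter one fails at `t₁`;
  -- comparing the two lines there gives the side of `q`.
  have hqt₁ : q < t₁ := by
    have := (hmem a ha t₁).trans_lt ht₁
    rw [EReal.coe_lt_coe_iff] at this
    nlinarith
  have hqt₂ : t₂ < q := by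
    have := (hmem b hb t₂).trans_lt ht₂
    rw [EReal.coe_lt_coe_iff] at this
    nlinarith
  obtain ⟨e₁, he₁, htail₁⟩ := exists_tail_bound hν hν0 ht₁
  obtain ⟨e₂, he₂, htail₂⟩ := exists_tail_bound hν hν0 ht₂
  -- Below `B`, so that the whole sum is at least `2^{nr}`; above `e₁` and `e₂`, so that the tails
  -- are negligible; within `ε` of `B` for the final count.
  obtain ⟨r, hr, hrB⟩ := exists_between (max_lt (max_lt he₁ he₂) (sub_lt_self B hε))
  have hrB' : (r : EReal) < lqSpectrum ν q := by rw [hB]; exact_mod_cast hrB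
  have her : max e₁ e₂ < r := (le_max_left _ _).trans_lt hr
  have hεr : B - ε < r := (le_max_right _ _).trans_lt hr
  filter_upwards [htail₁, htail₂, eventually_le_dyadicSum hν hν0 hlim hrB',
    (tendsto_two_rpow_mul (sub_pos.2 her)).eventually_ge_atTop 4] with n h₁ h₂ h₃ h₄
  set p : ℕ → ℝ := fun k => ν.real (dyadic n k) with hp
  have hppos : ∀ k ∈ chargedDyadic ν n, 0 < p k := fun k hk => measureReal_pos_of_mem hk
  let A₁ := (chargedDyadic ν n).filter fun k => (2 : ℝ) ^ (-(n * (a - ε))) ≤ p k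
  let A₂ := (chargedDyadic ν n).filter fun k => p k ≤ (2 : ℝ) ^ (-(n * (b + ε)))
  let G := (chargedDyadic ν n).filter fun k =>
    (2 : ℝ) ^ (-(n * (b + ε))) ≤ p k ∧ p k ≤ (2 : ℝ) ^ (-(n * (a - ε)))
  have hA₁ := h₁ A₁ (Finset.filter_subset _ _) fun k hk =>
    Real.rpow_le_rpow_of_nonpos (by positivity) (Finset.mem_filter.1 hk).2 (by linarith)
  have hA₂ := h₂ A₂ (Finset.filter_subset _ _) fun k hk =>
    Real.rpow_le_rpow measureReal_nonneg (Finset.mem_filter.1 hk).2 (by linarith)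
  have hG : ∑ k ∈ G, p k ^ q ≤ G.card * ((2 : ℝ) ^ (-(n * (a - ε)))) ^ q := by
    rw [← nsmul_eq_mul]
    exact Finset.sum_le_card_nsmul _ _ _ fun k hk =>
      Real.rpow_le_rpow measureReal_nonneg (Finset.mem_filter.1 hk).2.2 hq.1
  have hnn : ∀ k, 0 ≤ p k ^ q := fun k => Real.rpow_nonneg measureReal_nonneg _
  have hsum : dyadicSum ν n q ≤ ∑ k ∈ G, p k ^ q + ∑ k ∈ A₁, p k ^ q + ∑ k ∈ A₂, p k ^ q := by
    have hsub : chargedDyadic ν n ⊆ (G ∪ A₁) ∪ A₂ := by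
      intro k hk
      simp only [Finset.mem_union, G, A₁, A₂, Finset.mem_filter, hk, true_and]
      rcases le_total ((2 : ℝ) ^ (-(n * (a - ε)))) (p k) with h | h
      · exact Or.inl (Or.inr h)
      · rcases le_total ((2 : ℝ) ^ (-(n * (b + ε)))) (p k) with h' | h'
        · exact Or.inl (Or.inl ⟨h', h⟩)
        · exact Or.inr h'
    have hU : ∀ S T : Finset ℕ, ∑ k ∈ S ∪ T, p k ^ q ≤ ∑ k ∈ S, p k ^ q + ∑ k ∈ T, p k ^ q :=
      fun S T => by
        rw [← Finset.sum_union_inter]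
        linarith [Finset.sum_nonneg fun k (_ : k ∈ S ∩ T) => hnn k]
    calc dyadicSum ν n q ≤ ∑ k ∈ (G ∪ A₁) ∪ A₂, p k ^ q :=
          Finset.sum_le_sum_of_subset_of_nonneg hsub fun k _ _ => hnn k
      _ ≤ _ := (hU _ _).trans (by gcongr; exact hU _ _)
  have hmono : ∀ e ≤ max e₁ e₂, (2 : ℝ) ^ (n * e) ≤ (2 : ℝ) ^ (n * max e₁ e₂) := fun e he =>
    Real.rpow_le_rpow_of_exponent_le one_le_two (by gcongr)
  have hsplit : (2 : ℝ) ^ (n * r) = (2 : ℝ) ^ (n * (r - max e₁ e₂)) * (2 : ℝ) ^ (n * max e₁ e₂) := by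
    rw [← Real.rpow_add two_pos]; congr 1; ring
  -- For these `n` each tail is at most a quarter of `2^{nr}`, leaving half of it to `G`.
  have hhalf : 2⁻¹ * (2 : ℝ) ^ (n * r) ≤ G.card * ((2 : ℝ) ^ (-(n * (a - ε)))) ^ q := by
    have h5 : 4 * (2 : ℝ) ^ (n * max e₁ e₂) ≤ (2 : ℝ) ^ (n * r) := by
      rw [hsplit]; gcongr
    linarith [hmono e₁ (le_max_left _ _), hmono e₂ (le_max_right _ _)]
  refine ⟨G, (Finset.filter_subset _ _).trans (Finset.filter_subset _ _),
    fun k hk => (Finset.mem_filter.1 hk).2.1, ?_⟩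
  have hX : ((2 : ℝ) ^ (-(n * (a - ε)))) ^ q * (2 : ℝ) ^ (n * ((a - ε) * q)) = 1 := by
    rw [← Real.rpow_mul two_pos.le, ← Real.rpow_add two_pos]
    convert Real.rpow_zero (2 : ℝ) using 2
    ring
  -- One `ε` is lost in `r > B - ε`, the other in `(a - ε) q ≥ a q - ε`, as `q ≤ 1`.
  calc 2⁻¹ * (2 : ℝ) ^ (n * (a * q + B - 2 * ε))
      ≤ 2⁻¹ * (2 : ℝ) ^ (n * r + n * ((a - ε) * q)) := by
        gcongr
        · exact one_le_two
        · rw [← mul_add]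
          gcongr
          nlinarith [hq.2]
    _ = 2⁻¹ * (2 : ℝ) ^ (n * r) * (2 : ℝ) ^ (n * ((a - ε) * q)) := by
        rw [Real.rpow_add two_pos, mul_assoc]
    _ ≤ G.card * ((2 : ℝ) ^ (-(n * (a - ε)))) ^ q * (2 : ℝ) ^ (n * ((a - ε) * q)) := by gcongr
    _ = G.card := by rw [mul_assoc, hX, mul_one]

end Dyadic

/-! ### From dyadic intervals to the spectral dimension -/

/-- Drop the first and last interval, whose trapezoids would leave `[0,1]`, and keep the fullest
residue class modulo `3`. -/
theorem exists_separated_subset {n : ℕ} {G : Finset ℕ} (hG : G ⊆ Finset.range (2 ^ n)) :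
    ∃ s ⊆ G, (∀ k ∈ s, 1 ≤ k ∧ k + 2 ≤ 2 ^ n) ∧
      (∀ j ∈ s, ∀ k ∈ s, j ≠ k → j + 3 ≤ k ∨ k + 3 ≤ j) ∧ G.card ≤ 3 * s.card + 2 := by
  classical
  let G' := G.filter fun k => 1 ≤ k ∧ k + 2 ≤ 2 ^ n
  have hcard : G.card ≤ G'.card + 2 := by
    have hsub : G ⊆ G' ∪ {0, 2 ^ n - 1} := by
      intro k hk
      have := Finset.mem_range.1 (hG hk)
      simp only [G', Finset.mem_union, Finset.mem_filter, hk, true_and, Finset.mem_insert,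
        Finset.mem_singleton]
      omega
    exact (Finset.card_le_card hsub).trans ((Finset.card_union_le _ _).trans
      (Nat.add_le_add_left Finset.card_le_two _))
  have hsum : G'.card = ∑ i ∈ Finset.range 3, (G'.filter fun k => k % 3 = i).card :=
    Finset.card_eq_sum_card_fiberwise fun k _ => by
      simpa using Nat.mod_lt k (by norm_num)
  have hex : ∃ i, G'.card ≤ 3 * (G'.filter fun k => k % 3 = i).card := by
    by_contra! h
    have h0 := h 0
    have h1 := h 1
    have h2 := h 2
    simp only [Finset.sum_range_succ, Finset.range_zero, Finset.sum_empty] at hsum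
    omega
  obtain ⟨i, hi⟩ := hex
  refine ⟨G'.filter fun k => k % 3 = i, (Finset.filter_subset _ _).trans (Finset.filter_subset _ _),
    fun k hk => (Finset.mem_filter.1 (Finset.mem_filter.1 hk).1).2, fun j hj k hk hjk => ?_,
    by omega⟩
  have hj' := (Finset.mem_filter.1 hj).2
  have hk' := (Finset.mem_filter.1 hk).2
  omega

/-- Each point of `(0,1)` lies in a non-boundary dyadic interval of fine enough scale, and there are
countably many such intervals. -/
theorem exists_interior_dyadic_pos {ν : Measure ℝ} (hν : ν (Set.Ioo (0 : ℝ) 1)ᶜ = 0)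
    (hν0 : ν ≠ 0) : ∃ n k : ℕ, 1 ≤ k ∧ k + 2 ≤ 2 ^ n ∧ ν (dyadic n k) ≠ 0 := by
  by_contra! h
  have hsub : Set.Ioo (0 : ℝ) 1 ⊆
      ⋃ (n : ℕ) (k : ℕ) (_ : 1 ≤ k ∧ k + 2 ≤ 2 ^ n), dyadic n k := by
    intro y hy
    obtain ⟨n, hn⟩ := exists_pow_lt_of_lt_one (lt_min hy.1 (sub_pos.2 hy.2))
      (by norm_num : (2⁻¹ : ℝ) < 1)
    obtain ⟨h1, h2⟩ := lt_min_iff.1 hn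
    have hp : (0 : ℝ) < 2 ^ n := by positivity
    rw [inv_pow, inv_lt_iff_one_lt_mul₀ hp] at h1 h2
    have hmem : y ∈ Set.Ioc (0 : ℝ) 1 := ⟨hy.1, hy.2.le⟩
    rw [← biUnion_dyadic n] at hmem
    simp only [Set.mem_iUnion, Finset.mem_range, exists_prop] at hmem
    obtain ⟨k, -, hk⟩ := hmem
    simp only [Set.mem_iUnion, exists_prop]
    refine ⟨n, k, ⟨?_, ?_⟩, hk⟩
    · obtain ⟨-, hk2⟩ := hk
      rw [le_div_iff₀ hp] at hk2
      have : (0 : ℝ) < k := by linarith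
      exact_mod_cast this
    · obtain ⟨hk1, -⟩ := hk
      rw [div_lt_iff₀ hp] at hk1
      have : (k : ℝ) + 1 < 2 ^ n := by linarith
      have : k + 1 < 2 ^ n := by exact_mod_cast this
      omega
  have hzero : ν (Set.Ioo (0 : ℝ) 1) = 0 := by
    refine measure_mono_null hsub ?_
    simp only [measure_iUnion_null_iff]
    exact fun n k hk => h n k hk.1 hk.2
  apply hν0
  rw [← Measure.measure_univ_eq_zero, ← Set.union_compl_self (Set.Ioo (0 : ℝ) 1)]
  exact measure_union_null hzero hν

theorem le_log_eigenvalueCount_div {ν : Measure ℝ} {m : ℕ} {x r : ℝ} (hm : 1 ≤ m) (hx : 1 < x)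
    (hN : (m : ℕ∞) ≤ eigenvalueCount ν x) (h : r * Real.log x ≤ Real.log m) :
    (r : EReal) ≤ ENNReal.log (eigenvalueCount ν x : ENNReal) / (Real.log x : EReal) := by
  have hlx : 0 < Real.log x := Real.log_pos hx
  rw [EReal.le_div_iff_mul_le (by exact_mod_cast hlx) (EReal.coe_ne_top _)]
  have hm' : (0 : ℝ) < m := by exact_mod_cast hm
  calc (r : EReal) * (Real.log x : EReal) = ((r * Real.log x : ℝ) : EReal) :=
        (EReal.coe_mul _ _).symm
    _ ≤ (Real.log m : EReal) := by exact_mod_cast h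
    _ = ENNReal.log (m : ENNReal) := by
        rw [← ENNReal.ofReal_natCast, ENNReal.log_ofReal_of_pos hm']
    _ ≤ ENNReal.log (eigenvalueCount ν x : ENNReal) := by
        refine ENNReal.log_monotone ?_
        have := ENat.toENNReal_le.2 hN
        simpa using this

/-- A single eigenvalue suffices, since `log 1 = 0`; one charged interior interval provides it for
all large `x`. -/
theorem lowerSpectralDim_nonneg {ν : Measure ℝ} [IsFiniteMeasure ν]
    (hν : ν (Set.Ioo (0 : ℝ) 1)ᶜ = 0) (hν0 : ν ≠ 0) : 0 ≤ lowerSpectralDim ν := by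
  obtain ⟨n, k, hk1, hk2, hk⟩ := exists_interior_dyadic_pos hν hν0
  refine le_liminf_of_le (by isBoundedDefault) ?_
  filter_upwards [eventually_gt_atTop (2 * 2 ^ n / ν.real (dyadic n k)), eventually_gt_atTop 1]
    with x hx hx1
  refine le_log_eigenvalueCount_div (r := 0) (m := 1) le_rfl hx1 ?_ (by simp)
  have := card_le_eigenvalueCount_of_dyadic hν (s := {k}) (by simp [hk1, hk2]) (by simp)
    (ENNReal.toReal_pos hk (measure_ne_top _ _)) (by simp [measureReal_def]) hx
  simpa using this

theorem eventually_rpow_le_eigenvalueCount {ν : Measure ℝ} [IsFiniteMeasure ν]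
    (hν : ν (Set.Ioo (0 : ℝ) 1)ᶜ = 0) {c D : ℝ}
    (hG : ∀ᶠ n : ℕ in atTop, ∃ G ⊆ Finset.range (2 ^ n),
      (∀ k ∈ G, (2 : ℝ) ^ (-(n * c)) ≤ ν.real (dyadic n k)) ∧
      2⁻¹ * (2 : ℝ) ^ (n * D) ≤ G.card) {E : ℝ} (hE : E < D) (hD : 0 < D) :
    ∀ᶠ n : ℕ in atTop, ∃ m : ℕ, (2 : ℝ) ^ (n * E) ≤ m ∧
      ∀ x : ℝ, 2 * (2 : ℝ) ^ (n * (1 + c)) < x → (m : ℕ∞) ≤ eigenvalueCount ν x := by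
  -- With `X = 2^{nD} ≥ 12`, the selected family has at least `(X/2 - 2)/3 ≥ X/9` members, and `X/9
  -- ≥ 2^{nE}`.
  filter_upwards [hG, (tendsto_two_rpow_mul (sub_pos.2 hE)).eventually_ge_atTop 9,
    (tendsto_two_rpow_mul hD).eventually_ge_atTop 12] with n ⟨G, hGs, hGp, hGc⟩ h9 h12
  obtain ⟨s, hsG, hs, hsep, hcard⟩ := exists_separated_subset hGs
  refine ⟨s.card, ?_, fun x hx => ?_⟩
  · have h1 : (G.card : ℝ) ≤ 3 * s.card + 2 := by exact_mod_cast hcard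
    have h2 : (2 : ℝ) ^ (n * D) = (2 : ℝ) ^ (n * (D - E)) * (2 : ℝ) ^ (n * E) := by
      rw [← Real.rpow_add two_pos]; congr 1; ring
    have h3 : 9 * (2 : ℝ) ^ (n * E) ≤ (2 : ℝ) ^ (n * D) := by rw [h2]; gcongr
    linarith
  · refine card_le_eigenvalueCount_of_dyadic hν hs hsep (Real.rpow_pos_of_pos two_pos _)
      (fun k hk => hGp k (hsG hk)) (lt_of_eq_of_lt ?_ hx)
    rw [Real.rpow_neg two_pos.le, div_inv_eq_mul, mul_add, Real.rpow_add two_pos, mul_one,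
      Real.rpow_natCast, mul_assoc]

theorem le_lowerSpectralDim_of_eventually {ν : Measure ℝ} {κ E r : ℝ} (hκ : 0 < κ) (hr : 0 ≤ r)
    (hrE : r * κ < E)
    (h : ∀ᶠ n : ℕ in atTop, ∃ m : ℕ, (2 : ℝ) ^ (n * E) ≤ m ∧
      ∀ x : ℝ, 2 * (2 : ℝ) ^ (n * κ) < x → (m : ℕ∞) ≤ eigenvalueCount ν x) :
    (r : EReal) ≤ lowerSpectralDim ν := by
  have hl : 0 < Real.log 2 := Real.log_pos one_lt_two
  have hE : 0 < E := lt_of_le_of_lt (by positivity) hrE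
  -- For given `x` take the largest `n` with `nκ ≤ log₂ x - 2`; the `2` ensures `2·2^{nκ} ≤ x/2 <
  -- x`.
  have htend : Tendsto (fun x : ℝ => ⌊(Real.log x / Real.log 2 - 2) / κ⌋₊) atTop atTop :=
    tendsto_nat_floor_atTop.comp
      ((tendsto_atTop_add_const_right _ _ (Real.tendsto_log_atTop.atTop_div_const hl)).atTop_div_const
        hκ)
  refine le_liminf_of_le (by isBoundedDefault) ?_
  filter_upwards [htend.eventually h, eventually_gt_atTop 4,
    (Real.tendsto_log_atTop.atTop_div_const hl).eventually_ge_atTop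
      ((2 + κ) * E / (E - r * κ))] with x hx hx4 hy
  set y := Real.log x / Real.log 2 with hyd
  set n := ⌊(y - 2) / κ⌋₊ with hn
  obtain ⟨m, hm, hN⟩ := hx
  have hx0 : 0 < x := by linarith
  have hxy : x = (2 : ℝ) ^ y := by
    rw [Real.rpow_def_of_pos two_pos, hyd, mul_div_cancel₀ _ hl.ne', Real.exp_log hx0]
  have hy2 : 2 ≤ y := by
    rw [hyd, le_div_iff₀ hl]
    calc 2 * Real.log 2 = Real.log (2 ^ 2) := by rw [Real.log_pow]; norm_num
      _ ≤ Real.log x := Real.log_le_log (by norm_num) (by linarith)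
  have hnκ : n * κ ≤ y - 2 := by
    rw [← le_div_iff₀ hκ]
    exact Nat.floor_le (div_nonneg (by linarith) hκ.le)
  have hnκ' : y - 2 < (n + 1) * κ := by
    rw [← div_lt_iff₀ hκ]
    exact Nat.lt_floor_add_one _
  have hm0 : (0 : ℝ) < m := lt_of_lt_of_le (by positivity) hm
  refine le_log_eigenvalueCount_div (m := m) (by exact_mod_cast hm0) (by linarith) (hN x ?_) ?_
  · have h1 : (2 : ℝ) ^ (n * κ) ≤ (2 : ℝ) ^ (y - 2) :=
      Real.rpow_le_rpow_of_exponent_le one_le_two hnκ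
    have h2 : (2 : ℝ) ^ (y - 2) = x / 4 := by
      rw [Real.rpow_sub two_pos, ← hxy]; norm_num
    linarith
  · have h1 : n * E * Real.log 2 ≤ Real.log m := by
      rw [← Real.log_rpow two_pos]
      exact Real.log_le_log (by positivity) hm
    have h2 : Real.log x = y * Real.log 2 := by rw [hyd]; field_simp
    -- Rounding `n` down costs at most `(2 + κ) E` in `nκE ≥ yE - (2 + κ) E`, and the lower bound
    -- imposed on `y` absorbs this into `y (E - rκ)`.
    have h3 : r * y ≤ n * E := by
      rw [div_le_iff₀ (by linarith)] at hy
      have h4 : (y - 2) * E ≤ (n + 1) * κ * E := by gcongr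
      have : κ * (r * y) ≤ κ * (n * E) := by nlinarith
      exact le_of_mul_le_mul_left this hκ
    calc r * Real.log x = r * y * Real.log 2 := by rw [h2]; ring
      _ ≤ n * E * Real.log 2 := by gcongr
      _ ≤ Real.log m := h1

end KreinFeller

open KreinFeller

theorem proposition1p5 (ν : MeasureTheory.Measure ℝ) [MeasureTheory.IsFiniteMeasure ν]
    (hν : ν (Set.Ioo (0 : ℝ) 1)ᶜ = 0) (hν0 : ν ≠ 0)
    (q : ℝ) (hq : q ∈ Set.Icc (0 : ℝ) 1)
    (hlim : Tendsto (fun n : ℕ => (KreinFeller.lqSpectrumAt ν n q : EReal)) atTop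
      (𝓝 (KreinFeller.lqSpectrum ν q)))
    (a : ℝ) (b : EReal) (hab : (a : EReal) ≤ b)
    (hsub : -KreinFeller.lqSubdifferential ν q = {s : ℝ | (a : EReal) ≤ s ∧ (s : EReal) ≤ b}) :
    (((a * q : ℝ) : EReal) + KreinFeller.lqSpectrum ν q) / (1 + b)
      ≤ KreinFeller.lowerSpectralDim ν := by
  have hnn := lowerSpectralDim_nonneg hν hν0
  obtain ⟨B, hB⟩ := exists_lqSpectrum_eq_coe hν hν0 hq
  have hiff : ∀ s : ℝ, -s ∈ lqSubdifferential ν q ↔ (a : EReal) ≤ s ∧ (s : EReal) ≤ b := fun s => by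
    rw [← Set.mem_neg, hsub]
    rfl
  induction b with
  | bot => exact absurd hab (not_le.2 (EReal.bot_lt_coe a))
  | top =>
    -- Division by `⊤` in `EReal` gives `0`.
    rw [EReal.add_top_of_ne_bot (by decide), EReal.div_top]
    exact hnn
  | coe b =>
    simp only [EReal.coe_le_coe_iff] at hab hiff
    have hb := (hiff b).2 ⟨hab, le_rfl⟩
    have ha := (hiff a).2 ⟨le_rfl, hab⟩
    have hb0 : 0 ≤ b := nonneg_of_neg_mem_lqSubdifferential hν hν0 hB hb
    have hlhs : (((a * q : ℝ) : EReal) + lqSpectrum ν q) / (1 + b) =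
        (((a * q + B) / (1 + b) : ℝ) : EReal) := by
      rw [hB, EReal.coe_div, EReal.coe_add, EReal.coe_add, EReal.coe_one]
    rw [hlhs]
    by_contra! hlt
    obtain ⟨r, hr1, hr2⟩ := EReal.lt_iff_exists_real_btwn.1 hlt
    have hr0 : 0 < r := by exact_mod_cast hnn.trans_lt hr1
    rw [EReal.coe_lt_coe_iff, lt_div_iff₀ (by linarith)] at hr2
    -- What is needed is `r (1 + b + ε) < a q + B - 3ε`, that is `ε (r + 3)` below the numerator; `r
    -- + 4` leaves slack.
    set ε := (a * q + B - r * (1 + b)) / (r + 4) with hε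
    have hε0 : 0 < ε := div_pos (by linarith) (by linarith)
    have hεr : ε * (r + 4) = a * q + B - r * (1 + b) := div_mul_cancel₀ _ (by linarith)
    have hrb : 0 ≤ r * (1 + (b + ε)) := by positivity
    have hgood := eventually_exists_many_dyadic hν hν0 hq hB hlim ha hb
      (fun s hs h => hs.not_ge ((hiff s).1 h).1) (fun s hs h => hs.not_ge ((hiff s).1 h).2) hε0
    have hcount := eventually_rpow_le_eigenvalueCount hν hgood
      (E := a * q + B - 3 * ε) (by linarith) (by nlinarith)
    exact hr1.not_ge (le_lowerSpectralDim_of_eventually (by linarith) hr0.le (by nlinarith) hcount)
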